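/- Let $\mathbb H\simeq\mathbb R^4$ be the skew field of quaternions, let $d\lambda$ be Lebesgue measure on $\mathbb H$, and let $d\mu(q)=e^{-|q|^2}\,d\lambda(q)$. Let $L^2_{\mathbb H}(\mathbb H,d\mu)$ be the right quaternionic Hilbert space of (classes of) functions $f:\mathbb H\to\mathbb H$ that are square integrable with respect to $\mu$, with scalar product $\langle f,g\rangle=\int_{\mathbb H}\overline{f(q)}\,g(q)\,d\mu(q)$. Let $$\mathcal N(q,p)=\bigl((q-\bar p)^{-1}q\,(q-\bar p)-p\bigr)^{-1}=\bigl(q^2-2q\,\mathrm{Re}(p)+|p|^2\bigr)^{-1}(q-\bar p),$$ which for each $q$ is defined for almost every $p$, and let $\mathcal A_S=\int_0^\pi\!\int_0^\pi\sin\phi\,d\phi\,d\psi$ be the area of the hemisphere $\{\cos\phi\,\mathbf i+\sin\phi\cos\psi\,\mathbf j+\sin\phi\sin\psi\,\mathbf k:\ \phi,\psi\in(0,\pi)\}$ of imaginary units. Theorem. For every $f\in L^2_{\mathbb H}(\mathbb H,d\mu)$ the integral $$\mathcal C_{\mathbb H}f(q)=\frac1\pi\int_{\mathbb H}\mathcal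 N(q,p)f(p)\,d\mu(p)$$ converges absolutely for $\mu$-almost every $q$, and $\mathcal C_{\mathbb H}$ is a bounded, compact, right $\mathbb H$-linear operator from $L^2_{\mathbb H}(\mathbb H,d\mu)$ to itself with operator norm $\|\mathcal C_{\mathbb H}\|\le \mathcal A_S/\sqrt\pi$. Moreover, for every real $k>2$ it belongs to the $k$-Schatten class: the singular values $s_i\ge 0$ of $\mathcal C_{\mathbb H}$, that is, the eigenvalues (repeated with multiplicity) of $|\mathcal C_{\mathbb H}|=(\mathcal C_{\mathbb H}^*\mathcal C_{\mathbb H})^{1/2}$, satisfy $\sum_i s_i^k<\infty$. -/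

import Mathlib

open MeasureTheory MulOpposite
open scoped Quaternion

noncomputable section

namespace QuatCauchy

/-- The Borel sigma-algebra of the quaternions. -/
instance : MeasurableSpace ℍ := borel ℍ

instance : BorelSpace ℍ := ⟨rfl⟩

/-- The Gaussian measure `dμ = exp (-|q|²) dλ`. Here `volume` is the Lebesgue measure of the
Euclidean space `ℍ` (the unit cube on the orthonormal basis `1, i, j, k` has volume one). -/
def gaussMeasure : Measure ℍ :=
  (volume : Measure ℍ).withDensity fun q => ENNReal.ofReal (Real.exp (-‖q‖ ^ 2))

/-- The space of square integrable quaternion-valued functions on `ℍ` for the Gaussian measure. It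
is a right quaternionic vector space: `f` times the quaternion `a` (on the right) is
`op a • f`, and right linear maps are the `ℍᵐᵒᵖ`-linear ones. -/
abbrev L2H : Type := Lp ℍ 2 gaussMeasure

/-- The quaternionic scalar product `⟨f, g⟩ = ∫ conj(f(q)) g(q) dμ(q)`. -/
def qInner (f g : L2H) : ℍ := ∫ q, star (f q) * g q ∂gaussMeasure

/-- The slice regular Cauchy kernel. When `q ≠ star p` it is equal to
`(q² - 2 q Re(p) + |p|²)⁻¹ (q - star p)`. For each `q` it is well defined for
almost all `p`; elsewhere the convention `0⁻¹ = 0` applies. -/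
def cauchyKernel (q p : ℍ) : ℍ :=
  ((q - star p)⁻¹ * q * (q - star p) - p)⁻¹

/-- The weighted quaternionic Cauchy transform
`f ↦ (1/π) ∫ N(q,p) f(p) dμ(p)`. -/
def cauchyTransform (f : ℍ → ℍ) (q : ℍ) : ℍ :=
  (1 / Real.pi : ℝ) • ∫ p, cauchyKernel q p * f p ∂gaussMeasure

/-- The area `∫₀^π ∫₀^π sin φ dφ dψ` of the hemisphere
`{cos φ i + sin φ cos ψ j + sin φ sin ψ k : φ, ψ ∈ (0, π)}` of imaginary units. -/
def hemisphereArea : ℝ :=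
  ∫ _ψ in (0 : ℝ)..Real.pi, ∫ φ in (0 : ℝ)..Real.pi, Real.sin φ

/-- `S` is the adjoint of `T` for the quaternionic scalar product. -/
def IsQAdjoint (S T : L2H →L[ℍᵐᵒᵖ] L2H) : Prop :=
  ∀ f g : L2H, qInner (S f) g = qInner f (T g)

/-- `e` is a (quaternionic) Hilbert basis: an orthonormal family whose orthogonal complement
is zero. -/
structure IsQHilbertBasis {ι : Type} (e : ι → L2H) : Prop where
  norm_one : ∀ i, qInner (e i) (e i) = 1
  orthogonal : ∀ i j, i ≠ j → qInner (e i) (e j) = 0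
  complete : ∀ f : L2H, (∀ i, qInner (e i) f = 0) → f = 0

/-- `T` belongs to the `k`-Schatten class: there is a Hilbert basis of eigenvectors of `T* T`,
with eigenvalues `s i ^ 2`, such that the singular values `s i ≥ 0` of `T`
(the eigenvalues of `|T| = (T* T)^(1/2)`, repeated with multiplicity) satisfy `∑ s i ^ k < ∞`. -/
def IsSchatten (k : ℝ) (T : L2H →L[ℍᵐᵒᵖ] L2H) : Prop :=
  ∃ Tadj : L2H →L[ℍᵐᵒᵖ] L2H, IsQAdjoint Tadj T ∧
    ∃ (ι : Type) (e : ι → L2H) (s : ι → ℝ), IsQHilbertBasis e ∧ (∀ i, 0 ≤ s i) ∧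
      (∀ i, Tadj (T (e i)) = op ((s i ^ 2 : ℝ) : ℍ) • e i) ∧
      Summable fun i => s i ^ k

end QuatCauchy

end

noncomputable section

namespace QuatCauchy

open Set
open scoped ENNReal NNReal RealInnerProductSpace

/-! ### The Cauchy kernel -/

/-! Size of the kernel. The polynomial `charPoly q p` has real coefficients, so its norm is the
product of two distances in the half plane of pairs (Re, |Im|): from `q` to `p`, and from `q` to the
mirror image of `p`. The second dominates |q - star p|, whence |N(q,p)| ≤ 1/d with d =
`halfPlaneDist q p` (`norm_cauchyKernel_le`). Lebesgue measure on ℍ becomes 4πv² du dv on the half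
plane, and the Gaussian weight absorbs v². Integrals of φ(d) are therefore bounded, uniformly in
`q`, by 8π² ∫ r φ(r) dr (`lintegral_fun_halfPlaneDist_le`). In two dimensions 1/r is locally
integrable, so the Schur test gives almost everywhere absolute convergence and boundedness.

Compactness and Schatten classes. Cut the kernel at d = ε. The near part has norm O(ε) by the Schur
test. The far part is Hilbert-Schmidt, with squared norm O(ε^(-δ)) for every δ > 0, because 1/r²
misses integrability in the plane only logarithmically. Thus the operator is a norm limit of
Hilbert-Schmidt operators, hence compact, and at most O(ε^(-2-δ)) singular values exceed a fixed
multiple of ε. This makes their k-th powers summable for k > 2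
(`HasHilbertSchmidtSplitting.isSchatten`). The quaternionic eigenbasis of T*T comes from the real
spectral theorem and Zorn's lemma (`exists_eigenbasis`).

Norm. The Schur constant 9π² is too large, so the norm is estimated separately, by π. In polar
coordinates q = rω, p = sη the kernel is a power series whose terms pair the coefficient of g along
ω^m with that of f along η^(m+1), with a radial factor at most 1/max(r,s). The powers ω^m are not
orthogonal on the 3-sphere, but their Gram matrix has only three nonzero diagonals and absolute row
sums 4π², which gives a Bessel inequality (`sum_norm_sphereCoeff_sq_le`). Each half of the radial
kernel has squared Hilbert-Schmidt norm 1/16 for r³ exp(-r²) dr (`lintegral_sq_radialKernel`).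
Together these bound the form by π on unit vectors, and π ≤ 2√π, which is the stated bound. -/

/-- The distance of the points `(Re q, |Im q|)` and `(Re p, |Im p|)` of the half plane. -/
def halfPlaneDist (q p : ℍ) : ℝ := √((q.re - p.re) ^ 2 + (‖q.im‖ - ‖p.im‖) ^ 2)

lemma halfPlaneDist_comm (q p : ℍ) : halfPlaneDist q p = halfPlaneDist p q := by
  unfold halfPlaneDist
  congr 1
  ring

lemma halfPlaneDist_nonneg (q p : ℍ) : 0 ≤ halfPlaneDist q p := Real.sqrt_nonneg _

lemma norm_sq_eq (q : ℍ) : ‖q‖ ^ 2 = q.re ^ 2 + q.imI ^ 2 + q.imJ ^ 2 + q.imK ^ 2 := by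
  rw [sq, ← Quaternion.normSq_eq_norm_mul_self, Quaternion.normSq_def']

lemma norm_im_sq_eq (q : ℍ) : ‖q.im‖ ^ 2 = q.imI ^ 2 + q.imJ ^ 2 + q.imK ^ 2 := by
  rw [norm_sq_eq]
  simp

/-- The characteristic polynomial `q² - 2 q Re(p) + |p|²` of `p`, evaluated at `q`. -/
def charPoly (q p : ℍ) : ℍ := q * (q - star p) - (q - star p) * p

lemma charPoly_eq (q p : ℍ) :
    charPoly q p = q * q - q * ((2 * p.re : ℝ) : ℍ) + ((‖p‖ ^ 2 : ℝ) : ℍ) := by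
  have h1 : star p * p = ((‖p‖ ^ 2 : ℝ) : ℍ) := by
    rw [Quaternion.star_mul_self, Quaternion.normSq_eq_norm_mul_self, sq]
  have h2 : p + star p = ((2 * p.re : ℝ) : ℍ) := by
    rw [Quaternion.self_add_star]
    push_cast
    rfl
  rw [← h1, ← h2, charPoly]
  noncomm_ring

/-- In the complex plane containing `q`, the polynomial has the roots Re p ± I |Im p|, and the two
factors are the squared distances of `q` to these roots. The proof checks this in coordinates. -/
lemma norm_charPoly_sq (q p : ℍ) :
    ‖charPoly q p‖ ^ 2 = ((q.re - p.re) ^ 2 + (‖q.im‖ - ‖p.im‖) ^ 2) *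
      ((q.re - p.re) ^ 2 + (‖q.im‖ + ‖p.im‖) ^ 2) := by
  have h : ((q.re - p.re) ^ 2 + (‖q.im‖ - ‖p.im‖) ^ 2) *
      ((q.re - p.re) ^ 2 + (‖q.im‖ + ‖p.im‖) ^ 2) =
      ((q.re - p.re) ^ 2 + ‖q.im‖ ^ 2 + ‖p.im‖ ^ 2) ^ 2 - 4 * ‖q.im‖ ^ 2 * ‖p.im‖ ^ 2 := by
    ring
  rw [h, norm_im_sq_eq, norm_im_sq_eq, norm_sq_eq, charPoly]
  simp
  ring

lemma norm_sub_star_sq_le (q p : ℍ) :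
    ‖q - star p‖ ^ 2 ≤ (q.re - p.re) ^ 2 + (‖q.im‖ + ‖p.im‖) ^ 2 := by
  have h1 : ‖q - star p‖ ^ 2 = (q.re - p.re) ^ 2 + ‖q.im + p.im‖ ^ 2 := by
    rw [norm_sq_eq, norm_sq_eq]
    simp
    ring
  rw [h1]
  gcongr
  exact norm_add_le _ _

lemma cauchyKernel_eq {q p : ℍ} (h : q ≠ star p) :
    cauchyKernel q p = (charPoly q p)⁻¹ * (q - star p) := by
  have h' : q - star p ≠ 0 := sub_ne_zero.2 h
  have : (q - star p)⁻¹ * q * (q - star p) - p = (q - star p)⁻¹ * charPoly q p := by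
    rw [charPoly, mul_sub _ (q * _), ← mul_assoc, ← mul_assoc, inv_mul_cancel₀ h', one_mul]
  rw [cauchyKernel, this, mul_inv_rev, inv_inv]

/-- The numerator is at most the distance to the farther root, which cancels one factor of
`norm_charPoly_sq`. -/
lemma norm_cauchyKernel_le {q p : ℍ} (h : q ≠ star p) :
    ‖cauchyKernel q p‖ ≤ (halfPlaneDist q p)⁻¹ := by
  rw [cauchyKernel_eq h, norm_mul, norm_inv]
  have h1 := norm_charPoly_sq q p
  have h2 := norm_sub_star_sq_le q p
  have h3 : halfPlaneDist q p ^ 2 = (q.re - p.re) ^ 2 + (‖q.im‖ - ‖p.im‖) ^ 2 :=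
    Real.sq_sqrt (by positivity)
  rcases (halfPlaneDist_nonneg q p).eq_or_lt with h0 | h0
  -- On the singular set both sides are zero by the convention `0⁻¹ = 0`.
  · have : ‖charPoly q p‖ = 0 := by
      rw [← sq_eq_zero_iff, h1, ← h3, ← h0]
      simp
    rw [this, ← h0]
    simp
  · have h4 : 0 < ‖q - star p‖ := norm_pos_iff.2 (sub_ne_zero.2 h)
    have h6 : ‖q - star p‖ * halfPlaneDist q p ≤ ‖charPoly q p‖ := by
      refine le_of_sq_le_sq ?_ (norm_nonneg _)
      rw [mul_pow, h1, ← h3, mul_comm]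
      gcongr
    have h5 : 0 < ‖charPoly q p‖ := lt_of_lt_of_le (by positivity) h6
    rw [← div_eq_inv_mul, div_le_iff₀ h5, inv_mul_eq_div, le_div_iff₀ h0]
    exact h6

/-- The equation q s - s p = 1 has at most one solution when `charPoly q p` is nonzero, and
`charPoly q p` vanishes only if `q` and `p` share their real part and the norm of their imaginary
part. This identifies the kernel with a series without summing the series explicitly. -/
lemma cauchyKernel_eq_of_mul_sub_mul {q p s : ℍ} (h : ‖q‖ ≠ ‖p‖) (hs : q * s - s * p = 1) :
    cauchyKernel q p = s := by
  have h1 : q ≠ star p := by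
    rintro rfl
    exact h (norm_star p)
  have h2 : charPoly q p ≠ 0 := by
    intro h0
    have h3 := norm_charPoly_sq q p
    have e1 : ‖q‖ ^ 2 = q.re ^ 2 + ‖q.im‖ ^ 2 := by rw [norm_sq_eq, norm_im_sq_eq]; ring
    have e2 : ‖p‖ ^ 2 = p.re ^ 2 + ‖p.im‖ ^ 2 := by rw [norm_sq_eq, norm_im_sq_eq]; ring
    rw [h0, norm_zero, zero_pow two_ne_zero, eq_comm, mul_eq_zero] at h3
    have n1 := norm_nonneg q.im
    have n2 := norm_nonneg p.im
    have h4 : (q.re - p.re) ^ 2 + (‖q.im‖ - ‖p.im‖) ^ 2 = 0 := by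
      rcases h3 with h3 | h3
      · exact h3
      · nlinarith [sq_nonneg (q.re - p.re), mul_nonneg n1 n2]
    have h5 : q.re - p.re = 0 := by nlinarith [sq_nonneg (q.re - p.re), sq_nonneg (‖q.im‖ - ‖p.im‖)]
    have h6 : ‖q.im‖ - ‖p.im‖ = 0 := by
      nlinarith [sq_nonneg (q.re - p.re), sq_nonneg (‖q.im‖ - ‖p.im‖)]
    apply h
    rw [← sq_eq_sq₀ (norm_nonneg _) (norm_nonneg _), e1, e2, sub_eq_zero.1 h5, sub_eq_zero.1 h6]
  rw [cauchyKernel_eq h1, inv_mul_eq_iff_eq_mul₀ h2]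
  -- The coefficients of the polynomial are real, so they move past `s`; the right side becomes q -
  -- star p once q s - s p = 1.
  have h3 : charPoly q p * s = q * (q * s - s * p) - (q * s - s * p) * star p := by
    have c1 : p * star p = ((‖p‖ ^ 2 : ℝ) : ℍ) := by
      rw [Quaternion.self_mul_star, Quaternion.normSq_eq_norm_mul_self, sq]
    have c2 : p + star p = ((2 * p.re : ℝ) : ℍ) := by
      rw [Quaternion.self_add_star]
      push_cast
      rfl
    have e1 : q * ((2 * p.re : ℝ) : ℍ) * s = q * s * (p + star p) := by
      rw [c2, mul_assoc, mul_assoc, Quaternion.coe_commutes]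
    have e2 : ((‖p‖ ^ 2 : ℝ) : ℍ) * s = s * (p * star p) := by
      rw [c1, Quaternion.coe_commutes]
    rw [charPoly_eq, add_mul, sub_mul, e1, e2]
    noncomm_ring
  rw [h3, hs]
  simp

/-- The series converges geometrically, and its sum S satisfies q S = 1 + S p by a shift of the
index. The expansion for |q| < |p| works in the same way, with q S - 1 = S p. -/
lemma hasSum_cauchyKernel_of_norm_lt {q p : ℍ} (h : ‖p‖ < ‖q‖) :
    HasSum (fun n : ℕ => q⁻¹ ^ (n + 1) * p ^ n) (cauchyKernel q p) := by
  have hq0 : 0 < ‖q‖ := (norm_nonneg p).trans_lt h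
  have hq : q ≠ 0 := norm_pos_iff.1 hq0
  have hr : ‖q‖⁻¹ * ‖p‖ < 1 := by rwa [inv_mul_lt_one₀ hq0]
  have hsum : Summable (fun n : ℕ => q⁻¹ ^ (n + 1) * p ^ n) := by
    refine .of_norm ?_
    have := (summable_geometric_of_lt_one (by positivity) hr).mul_left ‖q‖⁻¹
    refine this.congr fun n => ?_
    rw [norm_mul, norm_pow, norm_pow, norm_inv]
    ring
  have hs := hsum.hasSum
  rwa [cauchyKernel_eq_of_mul_sub_mul h.ne' (s := ∑' n : ℕ, q⁻¹ ^ (n + 1) * p ^ n)]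
  have e1 := hs.mul_left q
  have e2 := hs.mul_right p
  have e3 : HasSum (fun n : ℕ => q * (q⁻¹ ^ (n + 1) * p ^ n))
      ((∑' n : ℕ, q⁻¹ ^ (n + 1) * p ^ n) * p + 1) := by
    have hf : (fun n : ℕ => q * (q⁻¹ ^ (n + 1 + 1) * p ^ (n + 1))) =
        fun n : ℕ => q⁻¹ ^ (n + 1) * p ^ n * p := by
      ext1 n
      rw [pow_succ' q⁻¹, mul_assoc q⁻¹, mul_inv_cancel_left₀ hq, pow_succ p, ← mul_assoc]
    have := (hasSum_nat_add_iff (f := fun n : ℕ => q * (q⁻¹ ^ (n + 1) * p ^ n))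
      (g := (∑' n : ℕ, q⁻¹ ^ (n + 1) * p ^ n) * p) 1).1 (by rw [hf]; exact e2)
    simpa [mul_inv_cancel₀ hq] using this
  rw [e1.unique e3]
  simp

lemma hasSum_cauchyKernel_of_lt_norm {q p : ℍ} (h : ‖q‖ < ‖p‖) :
    HasSum (fun n : ℕ => -(q ^ n * p⁻¹ ^ (n + 1))) (cauchyKernel q p) := by
  have hp0 : 0 < ‖p‖ := (norm_nonneg q).trans_lt h
  have hp : p ≠ 0 := norm_pos_iff.1 hp0
  have hr : ‖p‖⁻¹ * ‖q‖ < 1 := by rwa [inv_mul_lt_one₀ hp0]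
  have hsum : Summable (fun n : ℕ => -(q ^ n * p⁻¹ ^ (n + 1))) := by
    refine .of_norm ?_
    have := (summable_geometric_of_lt_one (by positivity) hr).mul_left ‖p‖⁻¹
    refine this.congr fun n => ?_
    rw [norm_neg, norm_mul, norm_pow, norm_pow, norm_inv]
    ring
  have hs := hsum.hasSum
  rwa [cauchyKernel_eq_of_mul_sub_mul h.ne (s := ∑' n : ℕ, -(q ^ n * p⁻¹ ^ (n + 1)))]
  have e1 := hs.mul_left q
  have e2 := hs.mul_right p
  have e3 : HasSum (fun n : ℕ => -(q ^ n * p⁻¹ ^ (n + 1)) * p)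
      (q * (∑' n : ℕ, -(q ^ n * p⁻¹ ^ (n + 1))) + -1) := by
    have hf : (fun n : ℕ => -(q ^ (n + 1) * p⁻¹ ^ (n + 1 + 1)) * p) =
        fun n : ℕ => q * -(q ^ n * p⁻¹ ^ (n + 1)) := by
      ext1 n
      rw [neg_mul, mul_assoc, pow_succ p⁻¹ (n + 1), mul_assoc, inv_mul_cancel₀ hp, mul_one,
        pow_succ' q, mul_neg, mul_assoc]
    have := (hasSum_nat_add_iff (f := fun n : ℕ => -(q ^ n * p⁻¹ ^ (n + 1)) * p)
      (g := q * ∑' n : ℕ, -(q ^ n * p⁻¹ ^ (n + 1))) 1).1 (by rw [hf]; exact e1)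
    simpa [inv_mul_cancel₀ hp] using this
  rw [e2.unique e3]
  simp

lemma measurable_cauchyKernel : Measurable fun x : ℍ × ℍ => cauchyKernel x.1 x.2 := by
  unfold cauchyKernel
  have : Measurable fun x : ℍ × ℍ => x.1 - star x.2 := by fun_prop
  exact (((this.inv.mul measurable_fst).mul this).sub measurable_snd).inv

lemma measurable_halfPlaneDist : Measurable fun x : ℍ × ℍ => halfPlaneDist x.1 x.2 := by
  unfold halfPlaneDist
  have h1 : Measurable fun x : ℍ => x.re := Quaternion.continuous_re.measurable
  have h2 : Measurable fun x : ℍ => ‖x.im‖ := Quaternion.continuous_im.norm.measurable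
  exact ((((h1.comp measurable_fst).sub (h1.comp measurable_snd)).pow_const 2).add
    (((h2.comp measurable_fst).sub (h2.comp measurable_snd)).pow_const 2)).sqrt

/-! ### Integration of functions of the real part and the norm of the imaginary part -/

/-- The linear coordinates `(Re q, Im q)` of a quaternion. -/
def reIm (q : ℍ) : ℝ × EuclideanSpace ℝ (Fin 3) := (q.re, !₂[q.imI, q.imJ, q.imK])

lemma measurePreserving_reIm : MeasurePreserving reIm volume volume := by
  have h1 := Quaternion.linearIsometryEquivTuple.measurePreserving
  have h2 := EuclideanSpace.volume_preserving_symm_measurableEquiv_toLp (Fin 4)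
  have h3 := volume_preserving_piFinSuccAbove (fun _ : Fin 4 => ℝ) 0
  have h4 := (EuclideanSpace.volume_preserving_symm_measurableEquiv_toLp (Fin 3)).symm
  have h5 := (MeasurePreserving.id (volume : Measure ℝ)).prod h4
  exact h5.comp (h3.comp (h2.comp h1))

lemma norm_reIm_snd (q : ℍ) : ‖(reIm q).2‖ = ‖q.im‖ := by
  rw [← sq_eq_sq₀ (norm_nonneg _) (norm_nonneg _), norm_im_sq_eq, EuclideanSpace.norm_sq_eq]
  simp [reIm, Fin.sum_univ_three]

lemma lintegral_fun_norm_addHaar {E : Type*} [NormedAddCommGroup E] [NormedSpace ℝ E]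
    [MeasurableSpace E] [Nontrivial E] (μ : Measure E) [FiniteDimensional ℝ E] [BorelSpace E]
    [μ.IsAddHaarMeasure] {f : ℝ → ℝ≥0∞} (hf : Measurable f) :
    ∫⁻ x, f ‖x‖ ∂μ = Module.finrank ℝ E * μ (Metric.ball 0 1) *
      ∫⁻ y in Ioi (0 : ℝ), ENNReal.ofReal (y ^ (Module.finrank ℝ E - 1)) * f y := by
  calc
    ∫⁻ x, f ‖x‖ ∂μ = ∫⁻ x : ({(0)}ᶜ : Set E), f ‖x.1‖ ∂(μ.comap (↑)) := by
      rw [lintegral_subtype_comap (measurableSet_singleton _).compl fun x => f ‖x‖,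
        restrict_compl_singleton]
    _ = ∫⁻ x, f x.2 ∂μ.toSphere.prod (.volumeIoiPow (Module.finrank ℝ E - 1)) := by
      simpa using (μ.measurePreserving_homeomorphUnitSphereProd.lintegral_comp_emb
        (Homeomorph.measurableEmbedding _) (f ∘ Subtype.val ∘ Prod.snd))
    _ = μ.toSphere univ * ∫⁻ x : Ioi (0 : ℝ), f x
          ∂.volumeIoiPow (Module.finrank ℝ E - 1) := by
      rw [lintegral_prod _ (by fun_prop)]
      simp only [lintegral_const]
      rw [mul_comm]
    _ = _ := by
      rw [μ.toSphere_apply_univ, Measure.volumeIoiPow, lintegral_withDensity_eq_lintegral_mul _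
        (by fun_prop) (by fun_prop)]
      congr 1
      exact lintegral_subtype_comap measurableSet_Ioi
        fun y => ENNReal.ofReal (y ^ (Module.finrank ℝ E - 1)) * f y

/-- Integrating out the imaginary directions. -/
lemma lintegral_re_norm_im {f : ℝ × ℝ → ℝ≥0∞} (hf : Measurable f) :
    ∫⁻ q : ℍ, f (q.re, ‖q.im‖) = ENNReal.ofReal (4 * Real.pi) *
      ∫⁻ x in univ ×ˢ Ioi (0 : ℝ), ENNReal.ofReal (x.2 ^ 2) * f x := by
  have h1 : ∫⁻ q : ℍ, f (q.re, ‖q.im‖) =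
      ∫⁻ x : ℝ × EuclideanSpace ℝ (Fin 3), f (x.1, ‖x.2‖) := by
    rw [← measurePreserving_reIm.lintegral_comp (by fun_prop)]
    simp only [norm_reIm_snd]
    rfl
  have h3 : (3 : ℝ≥0∞) * ENNReal.ofReal (Real.pi * 4 / 3) = ENNReal.ofReal (4 * Real.pi) := by
    rw [← ENNReal.ofReal_ofNat, ← ENNReal.ofReal_mul (by norm_num)]
    congr 1
    ring
  have h2 : ∀ u : ℝ, ∫⁻ y : EuclideanSpace ℝ (Fin 3), f (u, ‖y‖) = ENNReal.ofReal (4 * Real.pi) *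
      ∫⁻ v in Ioi (0 : ℝ), ENNReal.ofReal (v ^ 2) * f (u, v) := by
    intro u
    rw [lintegral_fun_norm_addHaar volume (f := fun v => f (u, v)) (by fun_prop)]
    simp only [finrank_euclideanSpace, Fintype.card_fin, EuclideanSpace.volume_ball_fin_three,
      ENNReal.ofReal_one, one_pow, one_mul]
    rw [Nat.cast_ofNat, h3]
  rw [h1, Measure.volume_eq_prod, lintegral_prod _ (by fun_prop)]
  simp_rw [h2]
  rw [lintegral_const_mul _ (by fun_prop), Measure.volume_eq_prod, ← Measure.prod_restrict,
    lintegral_prod _ (by fun_prop), Measure.restrict_univ]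

/-- The measure on the half plane obtained from the volume of `ℍ`. -/
lemma map_re_norm_im : Measure.map (fun q : ℍ => (q.re, ‖q.im‖)) volume =
    (volume.restrict (univ ×ˢ Ioi (0 : ℝ))).withDensity
      fun x : ℝ × ℝ => ENNReal.ofReal (4 * Real.pi * x.2 ^ 2) := by
  have hm : Measurable fun q : ℍ => (q.re, ‖q.im‖) :=
    Quaternion.continuous_re.measurable.prodMk Quaternion.continuous_im.norm.measurable
  refine Measure.ext_of_lintegral _ fun f hf => ?_
  rw [lintegral_map hf hm, lintegral_re_norm_im hf,
    lintegral_withDensity_eq_lintegral_mul _ (by fun_prop) hf,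
    ← lintegral_const_mul _ (by fun_prop)]
  refine lintegral_congr fun x => ?_
  rw [Pi.mul_apply, ENNReal.ofReal_mul (p := 4 * Real.pi) (by positivity), mul_assoc]

lemma integral_exp_neg_norm_sq : ∫ q : ℍ, Real.exp (-‖q‖ ^ 2) = Real.pi ^ 2 := by
  have := GaussianFourier.integral_rexp_neg_mul_sq_norm (V := ℍ) (b := 1) one_pos
  simp only [neg_mul, one_mul, div_one] at this
  rw [this, Quaternion.finrank_eq_four]
  norm_num

lemma gaussMeasure_univ : gaussMeasure univ = ENNReal.ofReal (Real.pi ^ 2) := by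
  have h0 := integral_exp_neg_norm_sq
  rw [gaussMeasure, withDensity_apply _ MeasurableSet.univ, Measure.restrict_univ,
    ← ofReal_integral_eq_lintegral_ofReal _ (by filter_upwards with q; positivity), h0]
  by_contra h
  rw [integral_undef h] at h0
  have := Real.pi_pos
  nlinarith [sq_pos_of_pos this]

instance : IsFiniteMeasure gaussMeasure := ⟨by rw [gaussMeasure_univ]; exact ENNReal.ofReal_lt_top⟩

lemma lintegral_gaussMeasure {f : ℍ → ℝ≥0∞} (hf : Measurable f) :
    ∫⁻ q, f q ∂gaussMeasure = ∫⁻ q, ENNReal.ofReal (Real.exp (-‖q‖ ^ 2)) * f q := by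
  rw [gaussMeasure, lintegral_withDensity_eq_lintegral_mul _ (by fun_prop) hf]
  rfl

lemma lintegral_fun_sqrt {φ : ℝ → ℝ≥0∞} (hφ : Measurable φ) (a b : ℝ) :
    ∫⁻ x : ℝ × ℝ, φ √((a - x.1) ^ 2 + (b - x.2) ^ 2) =
      ENNReal.ofReal (2 * Real.pi) * ∫⁻ r in Ioi (0 : ℝ), ENNReal.ofReal r * φ r := by
  have h1 : ∫⁻ x : ℝ × ℝ, φ √((a - x.1) ^ 2 + (b - x.2) ^ 2) =
      ∫⁻ x : ℝ × ℝ, φ √(x.1 ^ 2 + x.2 ^ 2) :=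
    lintegral_sub_left_eq_self (fun x : ℝ × ℝ => φ √(x.1 ^ 2 + x.2 ^ 2)) (a, b)
  have h2 : ∫⁻ x : ℝ × ℝ, φ √(x.1 ^ 2 + x.2 ^ 2) = ∫⁻ z : ℂ, φ ‖z‖ := by
    rw [← Complex.volume_preserving_equiv_real_prod.lintegral_comp (by fun_prop)]
    refine lintegral_congr fun z => ?_
    rw [Complex.norm_eq_sqrt_sq_add_sq]
    rfl
  rw [h1, h2, lintegral_fun_norm_addHaar volume hφ]
  simp only [Complex.finrank_real_complex, Complex.volume_ball, ENNReal.ofReal_one, one_pow,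
    one_mul, Nat.add_one_sub_one, pow_one, Nat.cast_ofNat]
  rw [ENNReal.ofReal_mul (by norm_num), ENNReal.ofReal_ofNat]
  congr 2
  rw [← NNReal.coe_real_pi, ENNReal.ofReal_coe_nnreal]

/-- The density 4πv² of the volume in the half plane is harmless because v² exp(-(u² + v²)) ≤ 1.
What remains is a planar integral of a radial function centred at the point of `q`; extending it
from the half plane to the whole plane makes the bound independent of `q`. -/
lemma lintegral_fun_halfPlaneDist_le {φ : ℝ → ℝ≥0∞} (hφ : Measurable φ) (q : ℍ) :
    ∫⁻ p, φ (halfPlaneDist q p) ∂gaussMeasure ≤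
      ENNReal.ofReal (8 * Real.pi ^ 2) * ∫⁻ r in Ioi (0 : ℝ), ENNReal.ofReal r * φ r := by
  have hm : Measurable fun p => φ (halfPlaneDist q p) :=
    hφ.comp (measurable_halfPlaneDist.comp measurable_prodMk_left)
  rw [lintegral_gaussMeasure hm]
  let g : ℝ × ℝ → ℝ≥0∞ := fun x => ENNReal.ofReal (Real.exp (-(x.1 ^ 2 + x.2 ^ 2))) *
    φ √((q.re - x.1) ^ 2 + (‖q.im‖ - x.2) ^ 2)
  have h1 : ∀ p : ℍ, ENNReal.ofReal (Real.exp (-‖p‖ ^ 2)) * φ (halfPlaneDist q p) =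
      g (p.re, ‖p.im‖) := by
    intro p
    have : ‖p‖ ^ 2 = p.re ^ 2 + ‖p.im‖ ^ 2 := by rw [norm_sq_eq, norm_im_sq_eq]; ring
    simp only [g, this]
    rfl
  simp_rw [h1]
  rw [lintegral_re_norm_im (by fun_prop)]
  have h2 : ∀ x : ℝ × ℝ, ENNReal.ofReal (x.2 ^ 2) * g x ≤
      φ √((q.re - x.1) ^ 2 + (‖q.im‖ - x.2) ^ 2) := by
    intro x
    simp only [g]
    rw [← mul_assoc, ← ENNReal.ofReal_mul (by positivity)]
    refine mul_le_of_le_one_left zero_le (ENNReal.ofReal_le_one.2 ?_)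
    have h3 : x.2 ^ 2 ≤ Real.exp (x.1 ^ 2 + x.2 ^ 2) := by
      have := Real.add_one_le_exp (x.1 ^ 2 + x.2 ^ 2)
      nlinarith [sq_nonneg x.1]
    rw [Real.exp_neg, ← div_eq_mul_inv]
    exact (div_le_one (Real.exp_pos _)).2 h3
  calc ENNReal.ofReal (4 * Real.pi) *
        ∫⁻ x in univ ×ˢ Ioi (0 : ℝ), ENNReal.ofReal (x.2 ^ 2) * g x
      ≤ ENNReal.ofReal (4 * Real.pi) *
        ∫⁻ x : ℝ × ℝ, φ √((q.re - x.1) ^ 2 + (‖q.im‖ - x.2) ^ 2) :=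
        mul_le_mul_right ((setLIntegral_le_lintegral _ _).trans (lintegral_mono h2)) _
    _ = _ := by
        rw [lintegral_fun_sqrt hφ, ← mul_assoc, ← ENNReal.ofReal_mul (by positivity)]
        congr 2
        ring

/-- The mean of the inverse distance over the points closer than `ε`. -/
lemma lintegral_inv_halfPlaneDist_near_le (q : ℍ) (ε : ℝ) :
    ∫⁻ p, (Iio ε).indicator (fun r => ENNReal.ofReal r⁻¹) (halfPlaneDist q p) ∂gaussMeasure ≤
      ENNReal.ofReal (8 * Real.pi ^ 2 * ε) := by
  have hm : Measurable ((Iio ε).indicator fun r : ℝ => ENNReal.ofReal r⁻¹) :=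
    Measurable.indicator (by fun_prop) measurableSet_Iio
  refine (lintegral_fun_halfPlaneDist_le hm q).trans ?_
  rw [ENNReal.ofReal_mul (q := ε) (by positivity)]
  refine mul_le_mul_right ?_ _
  calc ∫⁻ r in Ioi (0 : ℝ), ENNReal.ofReal r * (Iio ε).indicator (fun r => ENNReal.ofReal r⁻¹) r
      ≤ ∫⁻ r in Ioi (0 : ℝ), (Iio ε).indicator 1 r := by
        refine setLIntegral_mono (measurable_one.indicator measurableSet_Iio) fun r hr => ?_
        by_cases h : r ∈ Iio ε
        · rw [indicator_of_mem h, indicator_of_mem h, ← ENNReal.ofReal_mul (le_of_lt hr),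
            mul_inv_cancel₀ (ne_of_gt hr)]
          simp
        · simp [indicator_of_notMem h]
    _ = ENNReal.ofReal ε := by
        rw [lintegral_indicator_one measurableSet_Iio, Measure.restrict_apply measurableSet_Iio,
          inter_comm, Ioi_inter_Iio, Real.volume_Ioo, sub_zero]

/-- The inverse square distance is integrable, up to a small power, away from the diagonal. -/
lemma lintegral_inv_halfPlaneDist_sq_far_le (q : ℍ) {ε δ : ℝ} (hε : 0 < ε) (hε1 : ε ≤ 1)
    (hδ : 0 < δ) :
    ∫⁻ p, (Ici ε).indicator (fun r => ENNReal.ofReal (r⁻¹ ^ 2)) (halfPlaneDist q p) ∂gaussMeasure ≤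
      ENNReal.ofReal ((8 * Real.pi ^ 2 / δ + Real.pi ^ 2) * ε ^ (-δ)) := by
  set φ : ℝ → ℝ≥0∞ := (Iio 1).indicator fun r => ENNReal.ofReal (r ^ (δ - 2)) with hφ
  have hφm : Measurable φ := Measurable.indicator (by fun_prop) measurableSet_Iio
  have hφd : Measurable fun p => φ (halfPlaneDist q p) :=
    hφm.comp (measurable_halfPlaneDist.comp measurable_prodMk_left)
  -- For ε ≤ r < 1 write r⁻² = r^(-δ) r^(δ-2) and bound r^(-δ) by ε^(-δ). For r ≥ 1 both r⁻² ≤ 1 and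
  -- 1 ≤ ε^(-δ). The power δ - 2 is integrable against r dr near 0, with integral 1/δ.
  have key : ∀ r : ℝ, (Ici ε).indicator (fun r => ENNReal.ofReal (r⁻¹ ^ 2)) r ≤
      ENNReal.ofReal (ε ^ (-δ)) * (φ r + 1) := by
    intro r
    by_cases hr : r ∈ Ici ε
    · have hr' : ε ≤ r := hr
      have hr0 : 0 < r := hε.trans_le hr'
      rw [indicator_of_mem hr]
      by_cases h1 : r < 1
      · have : φ r = ENNReal.ofReal (r ^ (δ - 2)) := indicator_of_mem (show r ∈ Iio 1 from h1) _
        rw [this]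
        refine le_trans ?_ (mul_le_mul_right (le_self_add) _)
        rw [← ENNReal.ofReal_mul (by positivity)]
        apply ENNReal.ofReal_le_ofReal
        have e1 : r⁻¹ ^ 2 = r ^ (-δ) * r ^ (δ - 2) := by
          rw [← Real.rpow_add hr0, show -δ + (δ - 2) = -(2 : ℝ) by ring, Real.rpow_neg hr0.le,
            Real.rpow_two, inv_pow]
        rw [e1]
        gcongr ?_ * _
        exact Real.rpow_le_rpow_of_nonpos hε hr' (by linarith)
      · refine le_trans ?_ (mul_le_mul_right (le_add_self) _)
        rw [mul_one]
        apply ENNReal.ofReal_le_ofReal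
        have e1 : r⁻¹ ^ 2 ≤ 1 := pow_le_one₀ (by positivity) (inv_le_one_of_one_le₀ (by linarith))
        have e2 : 1 ≤ ε ^ (-δ) := Real.one_le_rpow_of_pos_of_le_one_of_nonpos hε hε1 (by linarith)
        linarith
    · simp [indicator_of_notMem hr]
  have hint : ∫⁻ r in Ioi (0 : ℝ), ENNReal.ofReal r * φ r ≤ ENNReal.ofReal δ⁻¹ := by
    calc ∫⁻ r in Ioi (0 : ℝ), ENNReal.ofReal r * φ r
        = ∫⁻ r in Ioi (0 : ℝ), (Iio 1).indicator (fun r => ENNReal.ofReal (r ^ (δ - 1))) r := by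
          refine setLIntegral_congr_fun measurableSet_Ioi fun r hr => ?_
          have hr0 : 0 < r := hr
          by_cases h : r ∈ Iio (1 : ℝ)
          · simp only [hφ, indicator_of_mem h]
            rw [← ENNReal.ofReal_mul hr0.le]
            congr 1
            rw [show δ - 1 = 1 + (δ - 2) by ring, Real.rpow_add hr0, Real.rpow_one]
          · simp [hφ, indicator_of_notMem h]
      _ = ∫⁻ r in Ioo (0 : ℝ) 1, ENNReal.ofReal (r ^ (δ - 1)) := by
          rw [lintegral_indicator measurableSet_Iio, Measure.restrict_restrict measurableSet_Iio,
            inter_comm, Ioi_inter_Iio]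
      _ ≤ ENNReal.ofReal δ⁻¹ := by
          have hi : IntegrableOn (fun r : ℝ => r ^ (δ - 1)) (Ioc 0 1) :=
            (intervalIntegral.intervalIntegrable_rpow' (by linarith)).1
          refine (lintegral_mono_set Ioo_subset_Ioc_self).trans ?_
          rw [← ofReal_integral_eq_lintegral_ofReal hi
            (by filter_upwards [ae_restrict_mem measurableSet_Ioc] with r hr
                exact Real.rpow_nonneg hr.1.le _),
            ← intervalIntegral.integral_of_le zero_le_one, integral_rpow (Or.inl (by linarith))]
          apply ENNReal.ofReal_le_ofReal
          rw [sub_add_cancel, Real.one_rpow, Real.zero_rpow hδ.ne', sub_zero, one_div]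
  calc ∫⁻ p, (Ici ε).indicator (fun r => ENNReal.ofReal (r⁻¹ ^ 2)) (halfPlaneDist q p)
        ∂gaussMeasure
      ≤ ∫⁻ p, ENNReal.ofReal (ε ^ (-δ)) * (φ (halfPlaneDist q p) + 1) ∂gaussMeasure :=
        lintegral_mono fun p => key _
    _ = ENNReal.ofReal (ε ^ (-δ)) *
          (∫⁻ p, φ (halfPlaneDist q p) ∂gaussMeasure + ENNReal.ofReal (Real.pi ^ 2)) := by
        rw [lintegral_const_mul _ (hφd.add_const 1), lintegral_add_left hφd, lintegral_one,
          gaussMeasure_univ]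
    _ ≤ ENNReal.ofReal (ε ^ (-δ)) * (ENNReal.ofReal (8 * Real.pi ^ 2) * ENNReal.ofReal δ⁻¹ +
          ENNReal.ofReal (Real.pi ^ 2)) := by
        gcongr
        exact (lintegral_fun_halfPlaneDist_le hφm q).trans (by gcongr)
    _ = _ := by
        rw [← ENNReal.ofReal_mul (by positivity), ← ENNReal.ofReal_add (by positivity)
          (by positivity), ← ENNReal.ofReal_mul (by positivity), div_eq_mul_inv, mul_comm]

/-! ### Integral operators satisfying the Schur test -/

lemma sq_lintegral_mul_le {α : Type*} [MeasurableSpace α] {μ : Measure α} {a b : α → ℝ≥0∞}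
    (ha : AEMeasurable a μ) (hb : AEMeasurable b μ) :
    (∫⁻ x, a x * b x ∂μ) ^ 2 ≤ (∫⁻ x, a x ^ 2 ∂μ) * ∫⁻ x, b x ^ 2 ∂μ := by
  have h := ENNReal.lintegral_mul_le_Lp_mul_Lq μ Real.HolderConjugate.two_two ha hb
  simp only [Pi.mul_apply, ENNReal.rpow_two] at h
  calc (∫⁻ x, a x * b x ∂μ) ^ 2
      ≤ ((∫⁻ x, a x ^ 2 ∂μ) ^ (1 / 2 : ℝ) * (∫⁻ x, b x ^ 2 ∂μ) ^ (1 / 2 : ℝ)) ^ 2 := by gcongr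
    _ = _ := by
      rw [mul_pow, ← ENNReal.rpow_two, ← ENNReal.rpow_two, ← ENNReal.rpow_mul,
        ← ENNReal.rpow_mul]
      norm_num

/-- Cauchy-Schwarz for the factors √w and √w b. -/
lemma sq_lintegral_mul_le_weight {α : Type*} [MeasurableSpace α] {μ : Measure α} {w b : α → ℝ≥0∞}
    (hw : AEMeasurable w μ) (hb : AEMeasurable b μ) :
    (∫⁻ x, w x * b x ∂μ) ^ 2 ≤ (∫⁻ x, w x ∂μ) * ∫⁻ x, w x * b x ^ 2 ∂μ := by
  have h := sq_lintegral_mul_le (μ := μ) (a := fun x => w x ^ (1 / 2 : ℝ))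
    (b := fun x => w x ^ (1 / 2 : ℝ) * b x) (by fun_prop) (by fun_prop)
  have e : ∀ x, (w x ^ (1 / 2 : ℝ)) ^ 2 = w x := fun x => by
    rw [← ENNReal.rpow_two, ← ENNReal.rpow_mul]
    norm_num
  simp only [← mul_assoc, mul_pow, ← sq, e] at h
  exact h

lemma eLpNorm_two_sq {α E : Type*} [MeasurableSpace α] [NormedAddCommGroup E] {μ : Measure α}
    (f : α → E) : eLpNorm f 2 μ ^ 2 = ∫⁻ x, ‖f x‖ₑ ^ 2 ∂μ := by
  have := eLpNorm_nnreal_pow_eq_lintegral (μ := μ) (f := f) (p := 2) two_ne_zero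
  simpa using this

lemma enorm_sq_eq_lintegral (f : L2H) : ‖f‖ₑ ^ 2 = ∫⁻ q, ‖f q‖ₑ ^ 2 ∂gaussMeasure := by
  rw [Lp.enorm_def, eLpNorm_two_sq]

lemma aemeasurable_enorm_coeFn (f : L2H) : AEMeasurable (fun q => ‖f q‖ₑ) gaussMeasure :=
  (Lp.aestronglyMeasurable f).enorm

/-- A kernel satisfying the hypotheses of the Schur test with constant `M`. -/
structure IsSchurKernel (k : ℍ → ℍ → ℍ) (M : ℝ≥0) : Prop where
  measurable : Measurable (Function.uncurry k)
  left : ∀ q, ∫⁻ p, ‖k q p‖ₑ ∂gaussMeasure ≤ M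
  right : ∀ p, ∫⁻ q, ‖k q p‖ₑ ∂gaussMeasure ≤ M

namespace IsSchurKernel

variable {k : ℍ → ℍ → ℍ} {M : ℝ≥0}

lemma measurable_enorm (hk : IsSchurKernel k M) :
    Measurable fun x : ℍ × ℍ => ‖k x.1 x.2‖ₑ := hk.measurable.enorm

lemma aemeasurable_mul (hk : IsSchurKernel k M) {F : ℍ → ℝ≥0∞} (hF : AEMeasurable F gaussMeasure) :
    AEMeasurable (fun x : ℍ × ℍ => ‖k x.1 x.2‖ₑ * F x.2) (gaussMeasure.prod gaussMeasure) :=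
  hk.measurable_enorm.aemeasurable.mul hF.comp_snd

/-- The Schur test: weighted Cauchy-Schwarz in `p` costs one factor `M` from the rows, and after
exchanging the integrals the columns cost the other. -/
lemma lintegral_sq_le (hk : IsSchurKernel k M) {F : ℍ → ℝ≥0∞} (hF : AEMeasurable F gaussMeasure) :
    ∫⁻ q, (∫⁻ p, ‖k q p‖ₑ * F p ∂gaussMeasure) ^ 2 ∂gaussMeasure ≤
      (M : ℝ≥0∞) ^ 2 * ∫⁻ p, F p ^ 2 ∂gaussMeasure := by
  calc ∫⁻ q, (∫⁻ p, ‖k q p‖ₑ * F p ∂gaussMeasure) ^ 2 ∂gaussMeasure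
      ≤ ∫⁻ q, M * ∫⁻ p, ‖k q p‖ₑ * F p ^ 2 ∂gaussMeasure ∂gaussMeasure := by
        refine lintegral_mono fun q => ?_
        have hm : Measurable fun p => ‖k q p‖ₑ := hk.measurable.of_uncurry_left.enorm
        have h1 := sq_lintegral_mul_le_weight hm.aemeasurable hF
        have h2 := hk.left q
        exact h1.trans (mul_le_mul_left h2 _)
    _ = M * ∫⁻ p, ∫⁻ q, ‖k q p‖ₑ * F p ^ 2 ∂gaussMeasure ∂gaussMeasure := by
        rw [lintegral_const_mul' _ _ ENNReal.coe_ne_top, lintegral_lintegral_swap]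
        exact hk.aemeasurable_mul (hF.pow_const 2)
    _ ≤ M * ∫⁻ p, M * F p ^ 2 ∂gaussMeasure := by
        refine mul_le_mul_right (lintegral_mono fun p => ?_) _
        have hm : Measurable fun q => ‖k q p‖ₑ := hk.measurable.of_uncurry_right.enorm
        rw [lintegral_mul_const _ hm]
        have h2 := hk.right p
        exact mul_le_mul_left h2 _
    _ = (M : ℝ≥0∞) ^ 2 * ∫⁻ p, F p ^ 2 ∂gaussMeasure := by
        rw [lintegral_const_mul' (M : ℝ≥0∞) _ ENNReal.coe_ne_top, ← mul_assoc, sq (M : ℝ≥0∞)]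

lemma lintegral_sq_coeFn_le (hk : IsSchurKernel k M) (f : L2H) :
    ∫⁻ q, (∫⁻ p, ‖k q p * f p‖ₑ ∂gaussMeasure) ^ 2 ∂gaussMeasure ≤ (M * ‖f‖ₑ) ^ 2 := by
  simp_rw [enorm_mul]
  rw [mul_pow, enorm_sq_eq_lintegral]
  exact hk.lintegral_sq_le (aemeasurable_enorm_coeFn f)

lemma aestronglyMeasurable_mul (hk : IsSchurKernel k M) (f : L2H) :
    AEStronglyMeasurable (fun x : ℍ × ℍ => k x.1 x.2 * f x.2) (gaussMeasure.prod gaussMeasure) :=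
  hk.measurable.aestronglyMeasurable.mul (Lp.aestronglyMeasurable f).comp_snd

lemma ae_integrable (hk : IsSchurKernel k M) (f : L2H) :
    ∀ᵐ q ∂gaussMeasure, Integrable (fun p => k q p * f p) gaussMeasure := by
  have h1 : ∀ᵐ q ∂gaussMeasure, (∫⁻ p, ‖k q p * f p‖ₑ ∂gaussMeasure) ^ 2 < ⊤ := by
    refine ae_lt_top' ?_ ((hk.lintegral_sq_coeFn_le f).trans_lt
      (ENNReal.pow_lt_top (ENNReal.mul_lt_top ENNReal.coe_lt_top enorm_lt_top))).ne
    exact (hk.aestronglyMeasurable_mul f).enorm.lintegral_prod_right'.pow_const 2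
  filter_upwards [h1] with q hq
  refine ⟨?_, ?_⟩
  · have hm : Measurable fun p => k q p := hk.measurable.comp measurable_prodMk_left
    exact hm.aestronglyMeasurable.mul (Lp.aestronglyMeasurable f)
  · rw [hasFiniteIntegral_iff_enorm]
    by_contra h
    rw [not_lt_top_iff] at h
    rw [h, ENNReal.top_pow two_ne_zero] at hq
    exact lt_irrefl _ hq

lemma eLpNorm_integral_le (hk : IsSchurKernel k M) (f : L2H) :
    eLpNorm (fun q => ∫ p, k q p * f p ∂gaussMeasure) 2 gaussMeasure ≤ M * ‖f‖ₑ := by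
  rw [← ENNReal.pow_le_pow_left_iff two_ne_zero, eLpNorm_two_sq]
  refine (lintegral_mono fun q => ?_).trans (hk.lintegral_sq_coeFn_le f)
  gcongr
  exact enorm_integral_le_lintegral_enorm _

lemma memLp_integral (hk : IsSchurKernel k M) (f : L2H) :
    MemLp (fun q => ∫ p, k q p * f p ∂gaussMeasure) 2 gaussMeasure :=
  ⟨(hk.aestronglyMeasurable_mul f).integral_prod_right', (hk.eLpNorm_integral_le f).trans_lt
    (ENNReal.mul_lt_top ENNReal.coe_lt_top enorm_lt_top)⟩

/-- The integral operator of a Schur kernel. -/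
def toCLM (hk : IsSchurKernel k M) : L2H →L[ℍᵐᵒᵖ] L2H :=
  LinearMap.mkContinuous
    { toFun := fun f => (hk.memLp_integral f).toLp _
      map_add' := fun f g => by
        rw [← MemLp.toLp_add]
        refine MemLp.toLp_congr _ _ ?_
        filter_upwards [hk.ae_integrable f, hk.ae_integrable g] with q hf hg
        rw [Pi.add_apply, ← integral_add hf hg]
        refine integral_congr_ae ?_
        filter_upwards [Lp.coeFn_add f g] with p hp
        rw [hp, Pi.add_apply, mul_add]
      map_smul' := fun a f => by
        rw [RingHom.id_apply, ← MemLp.toLp_const_smul]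
        refine MemLp.toLp_congr _ _ ?_
        filter_upwards [hk.ae_integrable f] with q hf
        rw [Pi.smul_apply, ← op_unop a, op_smul_eq_mul, ← integral_mul_const_of_integrable hf]
        refine integral_congr_ae ?_
        filter_upwards [Lp.coeFn_smul (op (unop a)) f] with p hp
        rw [hp, Pi.smul_apply, op_smul_eq_mul, mul_assoc] }
    M fun f => by
      have h : ‖(hk.memLp_integral f).toLp _‖ₑ ≤ M * ‖f‖ₑ := by
        rw [Lp.enorm_toLp]
        exact hk.eLpNorm_integral_le f
      have := ENNReal.toReal_mono (ENNReal.mul_lt_top ENNReal.coe_lt_top enorm_lt_top).ne h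
      simpa using this

lemma toCLM_ae_eq (hk : IsSchurKernel k M) (f : L2H) :
    hk.toCLM f =ᵐ[gaussMeasure] fun q => ∫ p, k q p * f p ∂gaussMeasure :=
  (hk.memLp_integral f).coeFn_toLp

lemma norm_toCLM_le (hk : IsSchurKernel k M) (f : L2H) : ‖hk.toCLM f‖ ≤ M * ‖f‖ := by
  have h : ‖hk.toCLM f‖ₑ ≤ M * ‖f‖ₑ := by
    change ‖(hk.memLp_integral f).toLp _‖ₑ ≤ _
    rw [Lp.enorm_toLp]
    exact hk.eLpNorm_integral_le f
  have := ENNReal.toReal_mono (ENNReal.mul_lt_top ENNReal.coe_lt_top enorm_lt_top).ne h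
  simpa using this

end IsSchurKernel

/-! ### The quaternionic scalar product and adjoints -/

lemma inner_eq_re (a b : ℍ) : ⟪a, b⟫ = (star a * b).re := by
  rw [Quaternion.inner_def]
  simp

lemma integrable_star_mul (f g : L2H) : Integrable (fun q => star (f q) * g q) gaussMeasure :=
  MemLp.integrable_mul (p := 2) (q := 2) (Lp.memLp f).star (Lp.memLp g)

lemma re_integral {α : Type*} [MeasurableSpace α] {μ : Measure α} {f : α → ℍ}
    (hf : Integrable f μ) : (∫ x, f x ∂μ).re = ∫ x, (f x).re ∂μ := by
  have h := (innerSL ℝ (1 : ℍ)).integral_comp_comm hf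
  simpa [inner_eq_re] using h.symm

lemma inner_eq_re_qInner (f g : L2H) : ⟪f, g⟫ = (qInner f g).re := by
  rw [L2.inner_def, qInner, re_integral (integrable_star_mul f g)]
  simp_rw [inner_eq_re]

lemma qInner_op_smul_left (u : ℍ) (f g : L2H) : qInner (op u • f) g = star u * qInner f g := by
  rw [qInner, qInner, ← integral_const_mul_of_integrable (integrable_star_mul f g)]
  refine integral_congr_ae ?_
  filter_upwards [Lp.coeFn_smul (op u) f] with q hq
  rw [hq, Pi.smul_apply, op_smul_eq_mul, star_mul, mul_assoc]

lemma qInner_op_smul_right (u : ℍ) (f g : L2H) : qInner f (op u • g) = qInner f g * u := by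
  rw [qInner, qInner, ← integral_mul_const_of_integrable (integrable_star_mul f g)]
  refine integral_congr_ae ?_
  filter_upwards [Lp.coeFn_smul (op u) g] with q hq
  rw [hq, Pi.smul_apply, op_smul_eq_mul, mul_assoc]

lemma inner_op_smul_left (u : ℍ) (f g : L2H) : ⟪op u • f, g⟫ = ⟪f, op (star u) • g⟫ := by
  rw [inner_eq_re_qInner, inner_eq_re_qInner, qInner_op_smul_left, qInner_op_smul_right]
  simp
  ring

/-- The real scalar product is the real part of the quaternionic one, and right multiples by all `u`
recover the other components. Taking `u` to be the difference of the two sides makes its squared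
norm vanish. Through this, real Hilbert space theory applies to the quaternionic structure. -/
lemma qInner_eq_of_inner_eq {f g f' g' : L2H}
    (h : ∀ u : ℍ, ⟪op u • f, g⟫ = ⟪op u • f', g'⟫) : qInner f g = qInner f' g' := by
  simp_rw [inner_eq_re_qInner, qInner_op_smul_left] at h
  have h1 := h (qInner f g - qInner f' g')
  rw [← sub_eq_zero, ← Quaternion.re_sub, ← mul_sub, ← inner_eq_re, inner_self_eq_zero,
    sub_eq_zero] at h1
  exact h1

lemma qInner_eq_zero_iff {f g : L2H} : qInner f g = 0 ↔ ∀ u : ℍ, ⟪op u • f, g⟫ = 0 := by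
  constructor
  · intro h u
    rw [inner_eq_re_qInner, qInner_op_smul_left, h]
    simp
  · intro h
    have h0 : qInner f (0 : L2H) = 0 := by
      rw [← zero_smul ℍᵐᵒᵖ (0 : L2H), ← op_zero, qInner_op_smul_right, mul_zero]
    rw [← h0]
    exact qInner_eq_of_inner_eq fun u => by rw [h u, inner_zero_right]

lemma qInner_eq_zero_symm {f g : L2H} (h : qInner f g = 0) : qInner g f = 0 := by
  rw [qInner_eq_zero_iff] at h ⊢
  intro u
  rw [inner_op_smul_left, real_inner_comm]
  exact h _

lemma qInner_self (f : L2H) : qInner f f = ((‖f‖ ^ 2 : ℝ) : ℍ) := by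
  have h1 : ∀ a : ℍ, star a * a = ((star a * a).re) • (1 : ℍ) := fun a => by
    rw [Quaternion.star_mul_self, Quaternion.re_coe, ← Quaternion.algebraMap_def,
      Algebra.algebraMap_eq_smul_one]
  rw [← real_inner_self_eq_norm_sq, inner_eq_re_qInner, qInner,
    re_integral (integrable_star_mul f f)]
  conv_lhs => enter [2, q]; rw [h1]
  rw [integral_smul_const, ← Quaternion.algebraMap_def, Algebra.algebraMap_eq_smul_one]

lemma op_coe_smul (r : ℝ) (f : L2H) : op (r : ℍ) • f = r • f := by
  refine Lp.ext ?_
  filter_upwards [Lp.coeFn_smul (op (r : ℍ)) f, Lp.coeFn_smul r f] with q h1 h2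
  rw [h1, h2, Pi.smul_apply, Pi.smul_apply, op_smul_eq_mul, ← Quaternion.coe_commutes,
    Quaternion.coe_mul_eq_smul]

/-- The adjoint of a right linear operator. -/
def qAdjoint (T : L2H →L[ℍᵐᵒᵖ] L2H) : L2H →L[ℍᵐᵒᵖ] L2H :=
  { toFun := ContinuousLinearMap.adjoint (T.restrictScalars ℝ)
    map_add' := map_add _
    map_smul' := fun a f => by
      refine ext_inner_right ℝ fun g => ?_
      rw [RingHom.id_apply, ← op_unop a, inner_op_smul_left,
        ContinuousLinearMap.adjoint_inner_left, ContinuousLinearMap.adjoint_inner_left,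
        inner_op_smul_left, ContinuousLinearMap.coe_restrictScalars', map_smul]
    cont := (ContinuousLinearMap.adjoint (T.restrictScalars ℝ)).continuous }

lemma inner_qAdjoint_left (T : L2H →L[ℍᵐᵒᵖ] L2H) (f g : L2H) :
    ⟪qAdjoint T f, g⟫ = ⟪f, T g⟫ :=
  ContinuousLinearMap.adjoint_inner_left (T.restrictScalars ℝ) g f

lemma isQAdjoint_qAdjoint (T : L2H →L[ℍᵐᵒᵖ] L2H) : IsQAdjoint (qAdjoint T) T := fun f g =>
  qInner_eq_of_inner_eq fun u => by rw [← map_smul, inner_qAdjoint_left]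

/-! ### The spectral theorem for `T* T` -/

/-- `S` is an orthonormal set of eigenvectors of `T* T`. -/
structure IsEigenSet (T : L2H →L[ℍᵐᵒᵖ] L2H) (S : Set L2H) : Prop where
  norm_one : ∀ e ∈ S, ‖e‖ = 1
  orthogonal : ∀ e ∈ S, ∀ e' ∈ S, e ≠ e' → qInner e e' = 0
  eigen : ∀ e ∈ S, ∃ c : ℝ, qAdjoint T (T e) = c • e

lemma IsEigenSet.sUnion {T : L2H →L[ℍᵐᵒᵖ] L2H} {c : Set (Set L2H)} (hc : IsChain (· ⊆ ·) c)
    (h : ∀ S ∈ c, IsEigenSet T S) : IsEigenSet T (⋃₀ c) := by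
  refine ⟨?_, ?_, ?_⟩
  · rintro e ⟨S, hS, he⟩
    exact (h S hS).norm_one e he
  · rintro e ⟨S, hS, he⟩ e' ⟨S', hS', he'⟩ hne
    rcases hc.total hS hS' with hh | hh
    · exact (h S' hS').orthogonal e (hh he) e' he' hne
    · exact (h S hS).orthogonal e he e' (hh he') hne
  · rintro e ⟨S, hS, he⟩
    exact (h S hS).eigen e he

lemma IsEigenSet.insert {T : L2H →L[ℍᵐᵒᵖ] L2H} {S : Set L2H} (h : IsEigenSet T S) {w : L2H}
    (hw : ‖w‖ = 1) (hwS : ∀ e ∈ S, qInner e w = 0) (hwT : ∃ c : ℝ, qAdjoint T (T w) = c • w) :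
    IsEigenSet T (insert w S) := by
  refine ⟨?_, ?_, ?_⟩
  · rintro e (rfl | he)
    exacts [hw, h.norm_one e he]
  · rintro e (rfl | he) e' (rfl | he') hne
    · exact absurd rfl hne
    · exact qInner_eq_zero_symm (hwS e' he')
    · exact hwS e he
    · exact h.orthogonal e he e' he' hne
  · rintro e (rfl | he)
    exacts [hwT, h.eigen e he]

/-- The real spectral theorem for the compact symmetric T*T gives an eigenspace W not orthogonal to
`f`; the projection `w` of `f` to W, normalised, is the new vector. It stays orthogonal to `S` in
the quaternionic sense: the right multiples of an eigenvector in `S` are eigenvectors with the same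
real eigenvalue. They lie in W, where `w` and `f` have the same products, or they belong to another
eigenvalue and are orthogonal to W. -/
lemma exists_eigenvector_orthogonal {T : L2H →L[ℍᵐᵒᵖ] L2H} (hT : IsCompactOperator T)
    {S : Set L2H} (h : IsEigenSet T S) {f : L2H} (hf : ∀ e ∈ S, qInner e f = 0) (hf0 : f ≠ 0) :
    ∃ w : L2H, ‖w‖ = 1 ∧ (∀ e ∈ S, qInner e w = 0) ∧ ∃ c : ℝ, qAdjoint T (T w) = c • w := by
  let A : L2H →L[ℝ] L2H := ((qAdjoint T).comp T).restrictScalars ℝ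
  have hA : ∀ x, A x = qAdjoint T (T x) := fun x => rfl
  have hsymm : (A : L2H →ₗ[ℝ] L2H).IsSymmetric := fun x y => by
    change ⟪A x, y⟫ = ⟪x, A y⟫
    rw [hA, hA, inner_qAdjoint_left, real_inner_comm, real_inner_comm _ x, inner_qAdjoint_left,
      real_inner_comm]
  have hcomp : IsCompactOperator A := hT.clm_comp (qAdjoint T)
  have hbot := ContinuousLinearMap.orthogonalComplement_iSup_eigenspaces_eq_bot hcomp hsymm
  obtain ⟨c, v, hv, hvf⟩ : ∃ c : ℝ, ∃ v ∈ Module.End.eigenspace (A : Module.End ℝ L2H) c,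
      ⟪v, f⟫ ≠ 0 := by
    by_contra! hcon
    apply hf0
    rw [← Submodule.mem_bot ℝ, ← hbot, ← Submodule.iInf_orthogonal, Submodule.mem_iInf]
    exact fun c => (Submodule.mem_orthogonal _ _).2 (hcon c)
  let W : Submodule ℝ L2H := Module.End.eigenspace (A : Module.End ℝ L2H) c
  have hW : ∀ x, x ∈ W ↔ A x = c • x := fun x => Module.End.mem_eigenspace_iff
  have hWc : IsClosed (W : Set L2H) := by
    have : (W : Set L2H) = {x | A x = c • x} := Set.ext hW
    rw [this]
    exact isClosed_eq A.continuous (continuous_const_smul c)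
  have : CompleteSpace W := hWc.completeSpace_coe
  set w : L2H := W.starProjection f with hw
  have hwW : w ∈ W := Submodule.starProjection_apply_mem _ _
  have hproj : ∀ x ∈ W, ⟪x, w⟫ = ⟪x, f⟫ := fun x hx => by
    have := Submodule.starProjection_inner_eq_zero (K := W) f x hx
    rw [inner_sub_left, sub_eq_zero, real_inner_comm, real_inner_comm x] at this
    exact this.symm
  have hw0 : w ≠ 0 := by
    intro h0
    apply hvf
    rw [← hproj v hv, h0, inner_zero_right]
  have hwS : ∀ e ∈ S, qInner e w = 0 := by
    intro e he
    rw [qInner_eq_zero_iff]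
    intro u
    obtain ⟨d, hd⟩ := h.eigen e he
    have hd' : A (op u • e) = d • (op u • e) := by
      rw [hA, map_smul, map_smul, hd, smul_comm]
    by_cases hdc : d = c
    · subst hdc
      rw [hproj _ ((hW _).2 hd')]
      exact qInner_eq_zero_iff.1 (hf e he) u
    · have h1 : ⟪A (op u • e), w⟫ = ⟪op u • e, A w⟫ := hsymm _ _
      rw [hd', (hW w).1 hwW, inner_smul_left, inner_smul_right, conj_trivial] at h1
      by_contra h2
      exact hdc (mul_right_cancel₀ h2 h1)
  have hn : ‖w‖ ≠ 0 := norm_ne_zero_iff.2 hw0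
  refine ⟨‖w‖⁻¹ • w, ?_, ?_, c, ?_⟩
  · rw [norm_smul, norm_inv, norm_norm, inv_mul_cancel₀ hn]
  · intro e he
    rw [← op_coe_smul, qInner_op_smul_right, hwS e he, zero_mul]
  · rw [← hA, map_smul, (hW w).1 hwW, smul_comm]

theorem exists_eigenbasis {T : L2H →L[ℍᵐᵒᵖ] L2H} (hT : IsCompactOperator T) :
    ∃ (ι : Type) (e : ι → L2H), IsQHilbertBasis e ∧ Orthonormal ℝ e ∧
      ∀ i, qAdjoint T (T (e i)) = op ((‖T (e i)‖ ^ 2 : ℝ) : ℍ) • e i := by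
  -- A maximal set of orthonormal eigenvectors is complete, since otherwise the preceding lemma
  -- enlarges it.
  obtain ⟨S, hS⟩ := zorn_subset {S | IsEigenSet T S}
    fun c hc hchain => ⟨⋃₀ c, IsEigenSet.sUnion hchain hc, fun s hs => subset_sUnion_of_mem hs⟩
  have hE : IsEigenSet T S := hS.prop
  refine ⟨S, fun i => i, ⟨fun i => ?_, fun i j hij => ?_, fun f hf => ?_⟩, ⟨fun i => ?_,
    fun i j hij => ?_⟩, fun i => ?_⟩
  · rw [qInner_self, hE.norm_one _ i.2]
    simp
  · exact hE.orthogonal _ i.2 _ j.2 fun h => hij (Subtype.ext h)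
  · by_contra hf0
    obtain ⟨w, hw1, hwS, hwT⟩ := exists_eigenvector_orthogonal hT hE (fun e he => hf ⟨e, he⟩) hf0
    have hmem : w ∈ S := hS.le_of_ge (hE.insert hw1 hwS hwT) (subset_insert w S) (mem_insert w S)
    have := hwS w hmem
    rw [qInner_self, hw1] at this
    simp at this
  · exact hE.norm_one _ i.2
  · change ⟪(i : L2H), (j : L2H)⟫ = 0
    rw [inner_eq_re_qInner, hE.orthogonal _ i.2 _ j.2 fun h => hij (Subtype.ext h)]
    rfl
  · obtain ⟨c, hc⟩ := hE.eigen _ i.2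
    have h1 : ⟪qAdjoint T (T i), (i : L2H)⟫ = ‖T i‖ ^ 2 := by
      rw [inner_qAdjoint_left, real_inner_self_eq_norm_sq]
    rw [hc, inner_smul_left, conj_trivial, real_inner_self_eq_norm_sq, hE.norm_one _ i.2, one_pow,
      mul_one] at h1
    rw [hc, op_coe_smul, h1]

/-! ### Hilbert-Schmidt bounds, compactness and Schatten classes -/

lemma isCompactOperator_of_approx {E : Type*} [NormedAddCommGroup E] [NormedSpace ℝ E]
    [CompleteSpace E] (T : E →L[ℝ] E)
    (h : ∀ η > 0, ∃ K : E →L[ℝ] E, IsCompactOperator K ∧ ∀ f, ‖T f - K f‖ ≤ η * ‖f‖) :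
    IsCompactOperator T := by
  have hcl : IsClosed {S : E →L[ℝ] E | IsCompactOperator S} := isClosed_setOfPred_isCompactOperator
  refine (hcl.closure_subset (Metric.mem_closure_iff.2 fun ε hε => ?_) : T ∈ _)
  obtain ⟨K, hK, hTK⟩ := h (ε / 2) (half_pos hε)
  refine ⟨K, hK, ?_⟩
  rw [dist_eq_norm]
  exact (ContinuousLinearMap.opNorm_le_bound _ (half_pos hε).le hTK).trans_lt (half_lt_self hε)

/-- Truncating `A` to finitely many vectors of a Hilbert basis gives finite rank operators.
Cauchy-Schwarz and Bessel bound the error by the square root of a tail of ∑ ‖A b_i‖². -/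
lemma isCompactOperator_of_sum_sq_le {E : Type} [NormedAddCommGroup E] [InnerProductSpace ℝ E]
    [CompleteSpace E] (A : E →L[ℝ] E) (C : ℝ)
    (h : ∀ {ι : Type} (e : ι → E), Orthonormal ℝ e → ∀ F : Finset ι, ∑ i ∈ F, ‖A (e i)‖ ^ 2 ≤ C) :
    IsCompactOperator A := by
  classical
  obtain ⟨w, b, hb⟩ := exists_hilbertBasis ℝ E
  have hbA := h b b.orthonormal
  have hsum : Summable fun i => ‖A (b i)‖ ^ 2 := summable_of_sum_le (fun i => sq_nonneg _) hbA
  refine isCompactOperator_of_approx A fun η hη => ?_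
  obtain ⟨s, hs⟩ := summable_iff_vanishing_norm.1 hsum (η ^ 2) (by positivity)
  refine ⟨∑ i ∈ s, (innerSL ℝ (b i)).smulRight (A (b i)), ?_, fun f => ?_⟩
  · have : ∀ t : Finset w,
        IsCompactOperator (∑ i ∈ t, (innerSL ℝ (b i)).smulRight (A (b i)) : E →L[ℝ] E) := by
      intro t
      induction t using Finset.induction_on with
      | empty => exact isCompactOperator_zero
      | insert i t hi ih =>
        rw [Finset.sum_insert hi]
        refine IsCompactOperator.add ?_ ih
        exact (isCompactOperator_of_locallyCompactSpace_dom (innerSL ℝ (b i))).clm_comp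
          (ContinuousLinearMap.toSpanSingleton ℝ (A (b i)))
    exact this s
  · have h1 : HasSum (fun i => ⟪b i, f⟫ • A (b i)) (A f) := by
      have := (b.hasSum_repr f).mapL A
      simpa only [map_smul, b.repr_apply_apply] using this
    have h2 : Filter.Tendsto (fun t => ∑ i ∈ t, ⟪b i, f⟫ • A (b i) -
        ∑ i ∈ s, ⟪b i, f⟫ • A (b i)) Filter.atTop
        (nhds (A f - ∑ i ∈ s, ⟪b i, f⟫ • A (b i))) := Filter.Tendsto.sub_const h1 _
    have h3 : (∑ i ∈ s, (innerSL ℝ (b i)).smulRight (A (b i)) : E →L[ℝ] E) f =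
        ∑ i ∈ s, ⟪b i, f⟫ • A (b i) := by
      simp
    rw [h3]
    refine le_of_tendsto h2.norm (Filter.eventually_atTop.2 ⟨s, fun t hst => ?_⟩)
    rw [← Finset.sum_sdiff hst, add_sub_cancel_right]
    have e1 : (∑ i ∈ t \ s, ‖⟪b i, f⟫‖ * ‖A (b i)‖) ^ 2 ≤ ‖f‖ ^ 2 * η ^ 2 := by
      refine (Finset.sum_mul_sq_le_sq_mul_sq _ _ _).trans ?_
      gcongr
      · exact b.orthonormal.sum_inner_products_le f
      · have := hs (t \ s) Finset.sdiff_disjoint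
        exact (le_abs_self _).trans this.le
    calc ‖∑ i ∈ t \ s, ⟪b i, f⟫ • A (b i)‖ ≤ ∑ i ∈ t \ s, ‖⟪b i, f⟫‖ * ‖A (b i)‖ := by
          refine (norm_sum_le _ _).trans (le_of_eq ?_)
          simp_rw [norm_smul]
      _ ≤ η * ‖f‖ := by
          refine le_of_sq_le_sq (e1.trans_eq ?_) (by positivity)
          ring

/-- Dyadic decomposition: at most C 2^((n+1) r) of the values lie in (2^(-n-1), 2^(-n)], and they
contribute at most C 2^r 2^(-n (k-r)), a geometric series because r < k. -/
lemma summable_rpow_of_card_le {ι : Type*} {t : ι → ℝ} (h0 : ∀ i, 0 ≤ t i) (h1 : ∀ i, t i ≤ 1)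
    {C r k : ℝ} (hr : 0 ≤ r) (hrk : r < k)
    (hcard : ∀ ε, 0 < ε → ε ≤ 1 → ∀ F : Finset ι, (∀ i ∈ F, ε ≤ t i) →
      (F.card : ℝ) ≤ C * ε ^ (-r)) :
    Summable fun i => t i ^ k := by
  classical
  have hk : 0 < k := hr.trans_lt hrk
  have hex : ∀ i, ∃ n : ℕ, 0 < t i → (1 / 2 : ℝ) ^ (n + 1) < t i ∧ t i ≤ (1 / 2 : ℝ) ^ n := by
    intro i
    by_cases hi : 0 < t i
    · obtain ⟨n, hn⟩ := exists_nat_pow_near_of_lt_one hi (h1 i) (by norm_num : (0 : ℝ) < 1 / 2)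
        (by norm_num)
      exact ⟨n, fun _ => hn⟩
    · exact ⟨0, fun h => absurd h hi⟩
  choose j hj using hex
  have hC : 0 ≤ C := by simpa using hcard 1 one_pos le_rfl ∅ (by simp)
  set ρ : ℝ := (1 / 2 : ℝ) ^ (k - r) with hρ
  have hρ0 : 0 < ρ := by positivity
  have hρ1 : ρ < 1 := Real.rpow_lt_one (by norm_num) (by norm_num) (by linarith)
  refine summable_of_sum_le (c := ∑' n : ℕ, C * 2 ^ r * ρ ^ n)
    (fun i => Real.rpow_nonneg (h0 i) k) fun F => ?_
  have hgeo : Summable fun n : ℕ => C * 2 ^ r * ρ ^ n :=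
    (summable_geometric_of_lt_one hρ0.le hρ1).mul_left _
  have e1 : ∑ i ∈ F, t i ^ k = ∑ i ∈ F with 0 < t i, t i ^ k := by
    rw [Finset.sum_filter]
    refine Finset.sum_congr rfl fun i _ => ?_
    split_ifs with h
    · rfl
    · rw [le_antisymm (not_lt.1 h) (h0 i), Real.zero_rpow hk.ne']
  set G := F.filter fun i => 0 < t i with hG
  have hGt : ∀ i ∈ G, 0 < t i := fun i hi => (Finset.mem_filter.1 hi).2
  rw [e1, ← Finset.sum_fiberwise_of_maps_to (g := j) (t := G.image j)
    fun i hi => Finset.mem_image_of_mem j hi]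
  refine (Finset.sum_le_sum fun n _ => ?_).trans
    (hgeo.sum_le_tsum (G.image j) fun n _ => by positivity)
  set H := G.filter fun i => j i = n with hH
  have hHG : ∀ i ∈ H, 0 < t i ∧ j i = n := fun i hi =>
    ⟨hGt i (Finset.mem_filter.1 hi).1, (Finset.mem_filter.1 hi).2⟩
  have h2 : ∀ i ∈ H, t i ^ k ≤ ((1 / 2 : ℝ) ^ n) ^ k := fun i hi => by
    have := (hj i (hHG i hi).1).2
    rw [(hHG i hi).2] at this
    exact Real.rpow_le_rpow (h0 i) this hk.le
  have h3 : (H.card : ℝ) ≤ C * ((1 / 2 : ℝ) ^ (n + 1)) ^ (-r) := by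
    refine hcard _ (by positivity) (pow_le_one₀ (by norm_num) (by norm_num)) H fun i hi => ?_
    have := (hj i (hHG i hi).1).1
    rw [(hHG i hi).2] at this
    exact this.le
  calc ∑ i ∈ H, t i ^ k ≤ ∑ i ∈ H, ((1 / 2 : ℝ) ^ n) ^ k := Finset.sum_le_sum h2
    _ = H.card * ((1 / 2 : ℝ) ^ n) ^ k := by rw [Finset.sum_const, nsmul_eq_mul]
    _ ≤ C * ((1 / 2 : ℝ) ^ (n + 1)) ^ (-r) * ((1 / 2 : ℝ) ^ n) ^ k := by gcongr
    _ = C * 2 ^ r * ρ ^ n := by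
      have hh : (0 : ℝ) < 1 / 2 := by norm_num
      have a1 : ((1 / 2 : ℝ) ^ (n + 1)) ^ (-r) = 2 ^ r * ((1 / 2 : ℝ) ^ n) ^ (-r) := by
        rw [pow_succ, Real.mul_rpow (by positivity) hh.le, Real.rpow_neg hh.le,
          ← Real.inv_rpow hh.le, one_div, inv_inv, mul_comm]
      have a2 : ρ ^ n = ((1 / 2 : ℝ) ^ n) ^ (-r) * ((1 / 2 : ℝ) ^ n) ^ k := by
        rw [← Real.rpow_add (by positivity), hρ, ← Real.rpow_natCast, ← Real.rpow_natCast,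
          ← Real.rpow_mul hh.le, ← Real.rpow_mul hh.le]
        congr 1
        ring
      rw [a1, a2]
      ring

/-- `T` is, for every `ε`, the sum of an operator of norm `O(ε)` and of an operator of
Hilbert-Schmidt norm `O(ε ^ (-δ))` for every `δ > 0`. -/
structure HasHilbertSchmidtSplitting (T : L2H →L[ℍᵐᵒᵖ] L2H) (c : ℝ) : Prop where
  pos : 0 < c
  split : ∀ δ : ℝ, 0 < δ → ∃ C : ℝ, ∀ ε : ℝ, 0 < ε → ε ≤ 1 → ∃ B : L2H →L[ℍᵐᵒᵖ] L2H,
    (∀ f, ‖B f‖ ≤ c * ε * ‖f‖) ∧ ∀ {ι : Type} (e : ι → L2H), Orthonormal ℝ e → ∀ F : Finset ι,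
      ∑ i ∈ F, ‖T (e i) - B (e i)‖ ^ 2 ≤ C * ε ^ (-δ)

lemma HasHilbertSchmidtSplitting.isCompactOperator {T : L2H →L[ℍᵐᵒᵖ] L2H} {c : ℝ}
    (h : HasHilbertSchmidtSplitting T c) : IsCompactOperator T := by
  obtain ⟨C, hC⟩ := h.split 1 one_pos
  refine isCompactOperator_of_approx (T.restrictScalars ℝ) fun η hη => ?_
  have hc := h.pos
  obtain ⟨B, hB, hF⟩ := hC (min 1 (η / c)) (by positivity) (min_le_left _ _)
  refine ⟨(T - B).restrictScalars ℝ, isCompactOperator_of_sum_sq_le _ _ fun e he F => hF e he F,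
    fun f => ?_⟩
  have h1 : T.restrictScalars ℝ f - (T - B).restrictScalars ℝ f = B f := by
    simp
  rw [h1]
  refine (hB f).trans ?_
  gcongr
  calc c * min 1 (η / c) ≤ c * (η / c) := by gcongr; exact min_le_right _ _
    _ = η := mul_div_cancel₀ _ hc.ne'

theorem HasHilbertSchmidtSplitting.isSchatten {T : L2H →L[ℍᵐᵒᵖ] L2H} {c : ℝ}
    (h : HasHilbertSchmidtSplitting T c) {k : ℝ} (hk : 2 < k) : IsSchatten k T := by
  obtain ⟨ι, e, hbasis, hon, heig⟩ := exists_eigenbasis h.isCompactOperator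
  refine ⟨qAdjoint T, isQAdjoint_qAdjoint T, ι, e, fun i => ‖T (e i)‖, hbasis,
    fun i => norm_nonneg _, heig, ?_⟩
  have hc := h.pos
  -- With δ = (k - 2)/2 the counting exponent 2 + δ is still smaller than `k`.
  obtain ⟨C, hC⟩ := h.split ((k - 2) / 2) (by linarith)
  -- The summand ‖T‖ makes the normalised singular values at most 1. The summand 2c ensures that ‖T
  -- e_i‖ ≥ ε M leaves at least c ε after subtracting B e_i, whose norm is at most c ε.
  set M : ℝ := 2 * c + ‖T.restrictScalars ℝ‖ with hM
  have hM0 : 0 < M := by positivity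
  have hTM : ∀ i, ‖T (e i)‖ ≤ M := fun i => by
    have := (T.restrictScalars ℝ).le_opNorm (e i)
    rw [hon.1 i, mul_one] at this
    exact this.trans (by linarith)
  have hs : Summable fun i => (‖T (e i)‖ / M) ^ k := by
    refine summable_rpow_of_card_le (C := C / c ^ 2) (r := 2 + (k - 2) / 2)
      (fun i => by positivity) (fun i => (div_le_one hM0).2 (hTM i)) (by linarith) (by linarith)
      fun ε hε hε1 F hF => ?_
    obtain ⟨B, hB, hBF⟩ := hC ε hε hε1
    have h1 : ∀ i ∈ F, (c * ε) ^ 2 ≤ ‖T (e i) - B (e i)‖ ^ 2 := fun i hi => by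
      have a1 : ε * M ≤ ‖T (e i)‖ := (le_div_iff₀ hM0).1 (hF i hi)
      have a2 := hB (e i)
      rw [hon.1 i, mul_one] at a2
      have a3 := norm_sub_norm_le (T (e i)) (B (e i))
      have a4 : ε * (2 * c) ≤ ε * M := by gcongr; linarith [norm_nonneg (T.restrictScalars ℝ)]
      gcongr
      linarith
    have h2 : F.card * (c * ε) ^ 2 ≤ C * ε ^ (-((k - 2) / 2)) := by
      rw [← nsmul_eq_mul, ← Finset.sum_const]
      exact (Finset.sum_le_sum h1).trans (hBF e hon F)
    have h3 : ε ^ (-(2 + (k - 2) / 2)) = ε ^ (-((k - 2) / 2)) / ε ^ 2 := by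
      rw [neg_add_rev, Real.rpow_add hε, Real.rpow_neg hε.le 2, Real.rpow_two]
      rfl
    rw [h3, div_mul_div_comm, ← mul_pow, le_div_iff₀ (by positivity)]
    exact h2
  have := hs.mul_left (M ^ k)
  refine this.congr fun i => ?_
  rw [← Real.mul_rpow hM0.le (by positivity), mul_div_cancel₀ _ hM0.ne']

/-! ### Hilbert-Schmidt norms of integral operators -/

/-- The family is orthonormal only over ℝ. The four real components of the integral are real scalar
products of `e i` with right multiples of star h by 1, i, j, k, and Bessel's inequality for each of
them produces the factor 4. -/
lemma sum_enorm_sq_integral_le {h : ℍ → ℍ} (hm : Measurable h) {ι : Type*} {e : ι → L2H}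
    (he : Orthonormal ℝ e) (F : Finset ι) :
    ∑ i ∈ F, ‖∫ p, h p * e i p ∂gaussMeasure‖ₑ ^ 2 ≤ 4 * ∫⁻ p, ‖h p‖ₑ ^ 2 ∂gaussMeasure := by
  by_cases hfin : ∫⁻ p, ‖h p‖ₑ ^ 2 ∂gaussMeasure = ⊤
  · rw [hfin, ENNReal.mul_top (by norm_num)]
    exact le_top
  have hlp : MemLp h 2 gaussMeasure := by
    refine ⟨hm.aestronglyMeasurable, ?_⟩
    rw [← eLpNorm_two_sq] at hfin
    by_contra hcon
    rw [not_lt_top_iff] at hcon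
    simp [hcon] at hfin
  set x : L2H := hlp.star.toLp _ with hx
  have hxq : ∀ i, ∫ p, h p * e i p ∂gaussMeasure = qInner x (e i) := fun i => by
    refine integral_congr_ae ?_
    filter_upwards [hlp.star.coeFn_toLp] with p hp
    rw [hp, Pi.star_apply, star_star]
  have hxn : ‖x‖ₑ ^ 2 = ∫⁻ p, ‖h p‖ₑ ^ 2 ∂gaussMeasure := by
    rw [hx, Lp.enorm_toLp, eLpNorm_two_sq]
    refine lintegral_congr fun p => ?_
    rw [Pi.star_apply, enorm_eq_nnnorm, enorm_eq_nnnorm, nnnorm_star]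
  have hbessel : ∀ u : ℍ, ∑ i ∈ F, ((star u * qInner x (e i)).re) ^ 2 ≤ ‖op u • x‖ ^ 2 := by
    intro u
    refine le_trans (le_of_eq (Finset.sum_congr rfl fun i _ => ?_)) (he.sum_inner_products_le _)
    rw [Real.norm_eq_abs, sq_abs, real_inner_comm, inner_eq_re_qInner, qInner_op_smul_left]
  have hnorm : ∀ u : ℍ, ‖u‖ = 1 → ‖op u • x‖ ^ 2 = ‖x‖ ^ 2 := by
    intro u hu
    rw [← real_inner_self_eq_norm_sq, inner_op_smul_left, smul_smul, ← op_mul,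
      Quaternion.self_mul_star, Quaternion.normSq_eq_norm_mul_self, hu, one_mul,
      Quaternion.coe_one, op_one, one_smul, real_inner_self_eq_norm_sq]
  have hreal : ∑ i ∈ F, ‖qInner x (e i)‖ ^ 2 ≤ 4 * ‖x‖ ^ 2 := by
    have key : ∀ a b c d : ℝ, a ^ 2 + b ^ 2 + c ^ 2 + d ^ 2 = 1 → ∑ i ∈ F,
        (a * (qInner x (e i)).re + b * (qInner x (e i)).imI + c * (qInner x (e i)).imJ +
          d * (qInner x (e i)).imK) ^ 2 ≤ ‖x‖ ^ 2 := by
      intro a b c d habcd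
      obtain ⟨u, rfl, rfl, rfl, rfl⟩ : ∃ u : ℍ, u.re = a ∧ u.imI = b ∧ u.imJ = c ∧ u.imK = d :=
        ⟨⟨a, b, c, d⟩, rfl, rfl, rfl, rfl⟩
      have hu : ‖u‖ = 1 := by
        rw [← sq_eq_sq₀ (norm_nonneg u) zero_le_one, norm_sq_eq, habcd, one_pow]
      refine le_trans (le_of_eq (Finset.sum_congr rfl fun i _ => ?_))
        ((hbessel u).trans_eq (hnorm u hu))
      simp
    have b1 := key 1 0 0 0 (by norm_num)
    have b2 := key 0 1 0 0 (by norm_num)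
    have b3 := key 0 0 1 0 (by norm_num)
    have b4 := key 0 0 0 1 (by norm_num)
    simp only [one_mul, zero_mul, add_zero, zero_add] at b1 b2 b3 b4
    simp_rw [norm_sq_eq (qInner _ _), Finset.sum_add_distrib]
    linarith
  simp_rw [hxq, ← hxn]
  rw [← ofReal_norm, ← ENNReal.ofReal_pow (norm_nonneg _), ← ENNReal.ofReal_ofNat,
    ← ENNReal.ofReal_mul (by norm_num)]
  simp_rw [← ofReal_norm, ← ENNReal.ofReal_pow (norm_nonneg _)]
  rw [← ENNReal.ofReal_sum_of_nonneg fun i _ => by positivity]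
  exact ENNReal.ofReal_le_ofReal hreal

lemma IsSchurKernel.sum_enorm_sq_le {k : ℍ → ℍ → ℍ} {M : ℝ≥0} (hk : IsSchurKernel k M)
    {ι : Type*} {e : ι → L2H} (he : Orthonormal ℝ e) (F : Finset ι) :
    ∑ i ∈ F, ‖hk.toCLM (e i)‖ₑ ^ 2 ≤
      4 * ∫⁻ q, ∫⁻ p, ‖k q p‖ₑ ^ 2 ∂gaussMeasure ∂gaussMeasure := by
  simp_rw [enorm_sq_eq_lintegral]
  rw [← lintegral_finsetSum' _ fun i _ => (aemeasurable_enorm_coeFn _).pow_const 2,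
    ← lintegral_const_mul' _ _ (by norm_num)]
  have hae : ∀ᵐ q ∂gaussMeasure, ∀ i ∈ F,
      hk.toCLM (e i) q = ∫ p, k q p * e i p ∂gaussMeasure :=
    (Finset.eventually_all F).2 fun i _ => hk.toCLM_ae_eq (e i)
  refine lintegral_mono_ae ?_
  filter_upwards [hae] with q hq
  rw [Finset.sum_congr rfl fun i hi => by rw [hq i hi]]
  exact sum_enorm_sq_integral_le hk.measurable.of_uncurry_left he F

/-! ### The Cauchy transform as an operator -/

/-- The kernel of the Cauchy transform, restricted to the pairs of points whose distance in the
half plane belongs to `s`. -/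
def cutKernel (s : Set ℝ) (q p : ℍ) : ℍ :=
  s.indicator (fun _ => (1 / Real.pi : ℝ) • cauchyKernel q p) (halfPlaneDist q p)

lemma cutKernel_univ (q p : ℍ) : cutKernel univ q p = (1 / Real.pi : ℝ) • cauchyKernel q p := by
  simp [cutKernel]

lemma cutKernel_add_compl (s : Set ℝ) (q p : ℍ) :
    cutKernel s q p + cutKernel sᶜ q p = cutKernel univ q p := by
  simp only [cutKernel, indicator_univ]
  rw [← Pi.add_apply, indicator_self_add_compl]

lemma measurable_cutKernel {s : Set ℝ} (hs : MeasurableSet s) :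
    Measurable (Function.uncurry (cutKernel s)) := by
  have : Function.uncurry (cutKernel s) = ((fun x : ℍ × ℍ => halfPlaneDist x.1 x.2) ⁻¹' s).indicator
      fun x => (1 / Real.pi : ℝ) • cauchyKernel x.1 x.2 := by
    ext1 x
    by_cases h : halfPlaneDist x.1 x.2 ∈ s <;> simp [Function.uncurry_def, cutKernel, h]
  rw [this]
  exact (measurable_cauchyKernel.const_smul (1 / Real.pi : ℝ)).indicator (measurable_halfPlaneDist hs)

lemma gaussMeasure_absolutelyContinuous : gaussMeasure ≪ volume :=
  withDensity_absolutelyContinuous _ _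

lemma ae_ne_star (q : ℍ) : ∀ᵐ p ∂gaussMeasure, q ≠ star p := by
  have h : ∀ᵐ p ∂(volume : Measure ℍ), p ≠ star q := by
    rw [ae_iff]
    simp
  filter_upwards [gaussMeasure_absolutelyContinuous.ae_le h] with p hp hq
  exact hp (by rw [hq, star_star])

lemma ae_ne_star' (p : ℍ) : ∀ᵐ q ∂gaussMeasure, q ≠ star p := by
  filter_upwards [ae_ne_star p] with q hq h
  exact hq (by rw [h, star_star])

lemma enorm_cutKernel_le (s : Set ℝ) {q p : ℍ} (h : q ≠ star p) :
    ‖cutKernel s q p‖ₑ ≤ s.indicator (fun r => ENNReal.ofReal r⁻¹) (halfPlaneDist q p) := by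
  by_cases hs : halfPlaneDist q p ∈ s
  · rw [cutKernel, indicator_of_mem hs, indicator_of_mem hs, ← ofReal_norm, norm_smul]
    apply ENNReal.ofReal_le_ofReal
    have h1 : ‖(1 / Real.pi : ℝ)‖ ≤ 1 := by
      rw [Real.norm_of_nonneg (by positivity), div_le_one Real.pi_pos]
      linarith [Real.pi_gt_three]
    calc ‖(1 / Real.pi : ℝ)‖ * ‖cauchyKernel q p‖ ≤ 1 * (halfPlaneDist q p)⁻¹ := by
          gcongr
          exact norm_cauchyKernel_le h
      _ = _ := one_mul _
  · simp [cutKernel, hs]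

/-- For distances at least 1 the kernel is bounded by 1, which is integrable because the Gaussian
measure is finite. -/
lemma enorm_cutKernel_le_univ (s : Set ℝ) {q p : ℍ} (h : q ≠ star p) :
    ‖cutKernel s q p‖ₑ ≤
      (Iio 1).indicator (fun r => ENNReal.ofReal r⁻¹) (halfPlaneDist q p) + 1 := by
  refine (enorm_cutKernel_le s h).trans ?_
  have h0 : s.indicator (fun r => ENNReal.ofReal r⁻¹) (halfPlaneDist q p) ≤
      ENNReal.ofReal (halfPlaneDist q p)⁻¹ :=
    indicator_le_self' (fun _ _ => zero_le) _
  refine h0.trans ?_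
  by_cases h1 : halfPlaneDist q p ∈ Iio (1 : ℝ)
  · rw [indicator_of_mem h1]
    exact le_self_add
  · refine le_add_left (ENNReal.ofReal_le_one.2 (inv_le_one_of_one_le₀ ?_))
    exact not_lt.1 h1

/-- The bound 1/d is symmetric in `q` and `p`, so rows and columns obey the same estimate, linear in
`ε`. -/
lemma isSchurKernel_Iio (ε : ℝ) :
    IsSchurKernel (cutKernel (Iio ε)) (8 * Real.pi ^ 2 * ε).toNNReal where
  measurable := measurable_cutKernel measurableSet_Iio
  left q := by
    refine (lintegral_mono_ae ?_).trans (lintegral_inv_halfPlaneDist_near_le q ε)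
    filter_upwards [ae_ne_star q] with p hp
    exact enorm_cutKernel_le _ hp
  right p := by
    refine (lintegral_mono_ae ?_).trans (lintegral_inv_halfPlaneDist_near_le p ε)
    filter_upwards [ae_ne_star' p] with q hq
    rw [halfPlaneDist_comm p q]
    exact enorm_cutKernel_le _ hq

lemma isSchurKernel_cutKernel {s : Set ℝ} (hs : MeasurableSet s) :
    IsSchurKernel (cutKernel s) (8 * Real.pi ^ 2 + Real.pi ^ 2).toNNReal := by
  have h : ∀ q, ∫⁻ p, ((Iio 1).indicator (fun r => ENNReal.ofReal r⁻¹) (halfPlaneDist q p) + 1)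
      ∂gaussMeasure ≤ ((8 * Real.pi ^ 2 + Real.pi ^ 2).toNNReal : ℝ≥0∞) := fun q => by
    rw [lintegral_add_right _ measurable_const, lintegral_one, gaussMeasure_univ]
    change _ ≤ ENNReal.ofReal _
    rw [ENNReal.ofReal_add (by positivity) (by positivity)]
    have := lintegral_inv_halfPlaneDist_near_le q 1
    rw [mul_one] at this
    gcongr
  refine ⟨measurable_cutKernel hs, fun q => ?_, fun p => ?_⟩
  · refine (lintegral_mono_ae ?_).trans (h q)
    filter_upwards [ae_ne_star q] with p hp
    exact enorm_cutKernel_le_univ _ hp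
  · refine (lintegral_mono_ae ?_).trans (h p)
    filter_upwards [ae_ne_star' p] with q hq
    rw [halfPlaneDist_comm p q]
    exact enorm_cutKernel_le_univ _ hq

/-- The weighted quaternionic Cauchy transform as a right linear operator. -/
def cauchyCLM : L2H →L[ℍᵐᵒᵖ] L2H := (isSchurKernel_cutKernel MeasurableSet.univ).toCLM

lemma ae_integrable_cauchyCLM (f : L2H) : ∀ᵐ q ∂gaussMeasure,
    Integrable (fun p => cauchyKernel q p * f p) gaussMeasure ∧
      cauchyCLM f q = cauchyTransform f q := by
  filter_upwards [(isSchurKernel_cutKernel MeasurableSet.univ).ae_integrable f,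
    (isSchurKernel_cutKernel MeasurableSet.univ).toCLM_ae_eq f] with q h1 h2
  simp_rw [cutKernel_univ, smul_mul_assoc] at h1 h2
  refine ⟨?_, ?_⟩
  · have := h1.smul Real.pi
    refine this.congr (ae_of_all _ fun p => ?_)
    rw [Pi.smul_apply, smul_smul, mul_one_div_cancel Real.pi_ne_zero, one_smul]
  · rw [cauchyCLM, h2, cauchyTransform, integral_smul]

lemma cauchyCLM_sub (s : Set ℝ) (hs : MeasurableSet s) {M : ℝ≥0} (h : IsSchurKernel (cutKernel s) M)
    (f : L2H) : cauchyCLM f - h.toCLM f = (isSchurKernel_cutKernel hs.compl).toCLM f := by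
  refine Lp.ext ?_
  filter_upwards [Lp.coeFn_sub (cauchyCLM f) (h.toCLM f), h.ae_integrable f,
    (isSchurKernel_cutKernel hs.compl).ae_integrable f, h.toCLM_ae_eq f,
    (isSchurKernel_cutKernel hs.compl).toCLM_ae_eq f,
    (isSchurKernel_cutKernel MeasurableSet.univ).toCLM_ae_eq f] with q h1 h2 h3 h4 h5 h6
  rw [h1, Pi.sub_apply, h4, h5, cauchyCLM, h6, sub_eq_iff_eq_add', ← integral_add h2 h3]
  simp_rw [← add_mul, cutKernel_add_compl]

lemma hasHilbertSchmidtSplitting_cauchyCLM :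
    HasHilbertSchmidtSplitting cauchyCLM (8 * Real.pi ^ 2) where
  pos := by positivity
  split δ hδ := by
    -- The factor 4 comes from real orthonormal families, the middle factor from the far integral in
    -- `p`, and the last π² is the total mass in `q`.
    refine ⟨4 * ((8 * Real.pi ^ 2 / δ + Real.pi ^ 2) * Real.pi ^ 2), fun ε hε hε1 =>
      ⟨(isSchurKernel_Iio ε).toCLM, fun f => ?_, fun e he F => ?_⟩⟩
    · refine ((isSchurKernel_Iio ε).norm_toCLM_le f).trans (le_of_eq ?_)
      rw [Real.coe_toNNReal _ (by positivity)]
    · have hk := isSchurKernel_cutKernel (measurableSet_Iio (a := ε)).compl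
      have h2 : ∀ q, ∫⁻ p, ‖cutKernel (Iio ε)ᶜ q p‖ₑ ^ 2 ∂gaussMeasure ≤
          ENNReal.ofReal ((8 * Real.pi ^ 2 / δ + Real.pi ^ 2) * ε ^ (-δ)) := fun q => by
        refine (lintegral_mono_ae ?_).trans (lintegral_inv_halfPlaneDist_sq_far_le q hε hε1 hδ)
        filter_upwards [ae_ne_star q] with p hp
        refine (pow_le_pow_left' (enorm_cutKernel_le _ hp) 2).trans (le_of_eq ?_)
        rw [compl_Iio]
        by_cases h : halfPlaneDist q p ∈ Ici ε
        · have : 0 ≤ (halfPlaneDist q p)⁻¹ := inv_nonneg.2 (halfPlaneDist_nonneg q p)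
          rw [indicator_of_mem h, indicator_of_mem h, ENNReal.ofReal_pow this]
        · rw [indicator_of_notMem h, indicator_of_notMem h, zero_pow two_ne_zero]
      have h3 : ∑ i ∈ F, ‖hk.toCLM (e i)‖ₑ ^ 2 ≤ ENNReal.ofReal
          (4 * ((8 * Real.pi ^ 2 / δ + Real.pi ^ 2) * Real.pi ^ 2) * ε ^ (-δ)) := by
        refine (hk.sum_enorm_sq_le he F).trans ?_
        calc 4 * ∫⁻ q, ∫⁻ p, ‖cutKernel (Iio ε)ᶜ q p‖ₑ ^ 2 ∂gaussMeasure ∂gaussMeasure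
            ≤ 4 * ∫⁻ q, ENNReal.ofReal ((8 * Real.pi ^ 2 / δ + Real.pi ^ 2) * ε ^ (-δ))
                ∂gaussMeasure := mul_le_mul_right (lintegral_mono h2) _
          _ = _ := by
            rw [lintegral_const, gaussMeasure_univ, ← ENNReal.ofReal_mul (by positivity),
              ← ENNReal.ofReal_ofNat, ← ENNReal.ofReal_mul (by norm_num)]
            congr 1
            ring
      simp_rw [← ofReal_norm, ← ENNReal.ofReal_pow (norm_nonneg _)] at h3
      rw [← ENNReal.ofReal_sum_of_nonneg fun i _ => by positivity,
        ENNReal.ofReal_le_ofReal_iff (by positivity)] at h3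
      refine le_trans (le_of_eq (Finset.sum_congr rfl fun i _ => ?_)) h3
      rw [cauchyCLM_sub _ measurableSet_Iio (isSchurKernel_Iio ε)]

/-! ### Polar coordinates -/

/-- The unit sphere of the quaternions. -/
abbrev USphere : Type := Metric.sphere (0 : ℍ) 1

/-- The surface measure of the unit sphere. -/
def sphereMeasure : Measure USphere := (volume : Measure ℍ).toSphere

instance : IsFiniteMeasure sphereMeasure := inferInstanceAs (IsFiniteMeasure (Measure.toSphere _))

/-- The radial part `r³ exp (-r²) dr` of the Gaussian measure. -/
def radialMeasure : Measure (Ioi (0 : ℝ)) :=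
  (Measure.volumeIoiPow 3).withDensity fun r => ENNReal.ofReal (Real.exp (-r.1 ^ 2))

/-- Polar coordinates. -/
def polarMap (x : Ioi (0 : ℝ) × USphere) : ℍ := x.1.1 • x.2.1

lemma norm_coe_uSphere (ω : USphere) : ‖(ω : ℍ)‖ = 1 := norm_eq_of_mem_sphere ω

lemma coe_uSphere_ne_zero (ω : USphere) : (ω : ℍ) ≠ 0 := ne_zero_of_mem_unit_sphere ω

lemma norm_polarMap (x : Ioi (0 : ℝ) × USphere) : ‖polarMap x‖ = x.1 := by
  have h : (0 : ℝ) < x.1 := x.1.2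
  rw [polarMap, norm_smul, norm_coe_uSphere, mul_one, Real.norm_of_nonneg h.le]

lemma measurable_polarMap : Measurable polarMap := by
  unfold polarMap
  fun_prop

lemma lintegral_radialMeasure {F : ℝ → ℝ≥0∞} (hF : Measurable F) :
    ∫⁻ r : Ioi (0 : ℝ), F r ∂radialMeasure =
      ∫⁻ r in Ioi (0 : ℝ), ENNReal.ofReal (r ^ 3 * Real.exp (-r ^ 2)) * F r := by
  rw [radialMeasure, lintegral_withDensity_eq_lintegral_mul _ (by fun_prop) (by fun_prop),
    Measure.volumeIoiPow, lintegral_withDensity_eq_lintegral_mul _ (by fun_prop) (by fun_prop),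
    ← lintegral_subtype_comap measurableSet_Ioi
      fun r => ENNReal.ofReal (r ^ 3 * Real.exp (-r ^ 2)) * F r]
  refine lintegral_congr fun r => ?_
  have h : (0 : ℝ) < r := r.2
  simp only [Pi.mul_apply]
  rw [ENNReal.ofReal_mul (by positivity), mul_assoc]

instance : SFinite radialMeasure := by
  unfold radialMeasure
  infer_instance

lemma measurePreserving_polarMap :
    MeasurePreserving polarMap (radialMeasure.prod sphereMeasure) gaussMeasure := by
  refine ⟨measurable_polarMap, (Measure.ext_of_lintegral _ fun f hf => ?_).symm⟩
  rw [lintegral_map hf measurable_polarMap, lintegral_gaussMeasure hf]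
  set g : ℍ → ℝ≥0∞ := fun q => ENNReal.ofReal (Real.exp (-‖q‖ ^ 2)) * f q with hg
  have hgm : Measurable g := by fun_prop
  have h3 : Module.finrank ℝ ℍ - 1 = 3 := by rw [Quaternion.finrank_eq_four]
  have h1 : ∫⁻ q : ℍ, g q = ∫⁻ x : USphere × Ioi (0 : ℝ), g (polarMap x.swap)
      ∂sphereMeasure.prod (Measure.volumeIoiPow 3) := by
    have hmp := (volume : Measure ℍ).measurePreserving_homeomorphUnitSphereProd
    rw [h3] at hmp
    have e := hmp.lintegral_comp (f := fun x => g (polarMap x.swap))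
      (hgm.comp (measurable_polarMap.comp measurable_swap))
    have e0 : ∫⁻ q : ({0}ᶜ : Set ℍ), g q ∂(volume.comap Subtype.val) = ∫⁻ q : ℍ, g q := by
      rw [lintegral_subtype_comap (measurableSet_singleton _).compl, restrict_compl_singleton]
    rw [sphereMeasure, ← e, ← e0]
    refine lintegral_congr fun q => ?_
    congr 1
    have hq : ‖(q : ℍ)‖ ≠ 0 := norm_ne_zero_iff.2 q.2
    simp [polarMap, smul_smul, mul_inv_cancel₀ hq]
  rw [h1, radialMeasure, prod_withDensity_left (by fun_prop),
    lintegral_withDensity_eq_lintegral_mul _ (by fun_prop)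
      (show Measurable fun a => f (polarMap a) from hf.comp measurable_polarMap),
    ← lintegral_prod_swap]
  refine lintegral_congr fun x => ?_
  simp only [hg, norm_polarMap, Pi.mul_apply, Prod.swap]

/-! ### Moments of the powers on the unit sphere -/

/-- Powers of `q` stay in the plane spanned by 1 and Im q, where Im q squares to -|Im q|² and so
behaves like |Im q| times the imaginary unit of ℂ. -/
lemma exists_pow_eq (q : ℍ) (k : ℕ) : ∃ a b : ℝ, q ^ k = (a : ℍ) + b • q.im ∧
    ((q.re : ℂ) + ‖q.im‖ * Complex.I) ^ k = a + (b * ‖q.im‖) * Complex.I := by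
  have him : q.im * q.im = (-‖q.im‖ ^ 2 : ℝ) • (1 : ℍ) := by
    have h := norm_im_sq_eq q
    generalize ‖q.im‖ = v at h
    rw [h]
    ext <;> simp <;> ring
  have hc : ∃ c : ℝ, c = -‖q.im‖ ^ 2 := ⟨_, rfl⟩
  obtain ⟨c, hc⟩ := hc
  rw [← hc] at him
  generalize ‖q.im‖ = v at hc
  induction k with
  | zero => exact ⟨1, 0, by simp, by simp⟩
  | succ k ih =>
    obtain ⟨a, b, h1, h2⟩ := ih
    refine ⟨a * q.re + b * c, a + b * q.re, ?_, ?_⟩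
    · have hq : q = (q.re : ℍ) + q.im := (Quaternion.re_add_im q).symm
      rw [pow_succ, h1]
      nth_rewrite 2 [hq]
      rw [add_mul, mul_add, mul_add, smul_mul_assoc, smul_mul_assoc, him, ← Quaternion.coe_mul]
      ext <;> simp <;> ring
    · rw [pow_succ, h2, hc]
      push_cast
      ring_nf
      rw [Complex.I_sq]
      ring

lemma re_pow_eq (q : ℍ) (k : ℕ) :
    (q ^ k).re = (((q.re : ℂ) + ‖q.im‖ * Complex.I) ^ k).re := by
  obtain ⟨a, b, h1, h2⟩ := exists_pow_eq q k
  rw [h1, h2]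
  simp

/-- The moments of the powers on the unit sphere. -/
def sphereMoment (k : ℤ) : ℝ :=
  if k = 0 then 2 * Real.pi ^ 2 else if k = 2 ∨ k = -2 then -Real.pi ^ 2 else 0

lemma integral_cos_int_mul (j : ℤ) :
    ∫ θ in (0 : ℝ)..Real.pi, Real.cos (j * θ) = if j = 0 then Real.pi else 0 := by
  split_ifs with h
  · simp [h]
  · have hj : (j : ℝ) ≠ 0 := Int.cast_ne_zero.2 h
    rw [intervalIntegral.integral_comp_mul_left _ hj]
    simp [Real.sin_int_mul_pi]

/-- Since sin² θ = (1 - cos 2θ)/2, only the frequencies k and k ± 2 occur. The factor 4π is the area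
of the unit sphere of imaginary directions. -/
lemma integral_sin_sq_mul_cos (k : ℤ) :
    4 * Real.pi * ∫ θ in (0 : ℝ)..Real.pi, Real.sin θ ^ 2 * Real.cos (k * θ) = sphereMoment k := by
  have h : ∀ θ : ℝ, Real.sin θ ^ 2 * Real.cos (k * θ) = 1 / 2 * Real.cos ((k : ℤ) * θ) -
      1 / 4 * Real.cos ((k + 2 : ℤ) * θ) - 1 / 4 * Real.cos ((k - 2 : ℤ) * θ) := by
    intro θ
    have e1 : ((k + 2 : ℤ) : ℝ) * θ = k * θ + 2 * θ := by push_cast; ring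
    have e2 : ((k - 2 : ℤ) : ℝ) * θ = k * θ - 2 * θ := by push_cast; ring
    rw [e1, e2, Real.cos_add, Real.cos_sub, Real.cos_two_mul, Real.sin_sq]
    ring
  have hi : ∀ (c : ℝ) (j : ℤ), IntervalIntegrable (fun θ : ℝ => c * Real.cos (j * θ)) volume 0
      Real.pi := fun c j => Continuous.intervalIntegrable (by fun_prop) _ _
  simp_rw [h]
  rw [intervalIntegral.integral_sub ((hi _ _).sub (hi _ _)) (hi _ _),
    intervalIntegral.integral_sub (hi _ _) (hi _ _), intervalIntegral.integral_const_mul,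
    intervalIntegral.integral_const_mul, intervalIntegral.integral_const_mul,
    integral_cos_int_mul, integral_cos_int_mul, integral_cos_int_mul, sphereMoment]
  split_ifs <;> first | omega | ring

/-! ### Polar coordinates -/
-- Conjugation, and the integrals of powers over the unit sphere
lemma star_real_smul (r : ℝ) (q : ℍ) : star (r • q) = r • star q := by
  ext <;> simp

/-- The conjugation, as a linear isometry. -/
def starIsometry : ℍ ≃ₗᵢ[ℝ] ℍ where
  toFun := star
  invFun := star
  map_add' := star_add
  map_smul' := star_real_smul
  left_inv := star_star
  right_inv := star_star
  norm_map' := norm_star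

lemma integral_star {α : Type*} [MeasurableSpace α] {μ : Measure α} (f : α → ℍ) :
    ∫ x, star (f x) ∂μ = star (∫ x, f x ∂μ) :=
  starIsometry.toContinuousLinearEquiv.integral_comp_comm f

lemma measurePreserving_star : MeasurePreserving (star : ℍ → ℍ) gaussMeasure gaussMeasure := by
  have hm : Measurable (star : ℍ → ℍ) := continuous_star.measurable
  refine ⟨hm, Measure.ext_of_lintegral _ fun f hf => ?_⟩
  have hv : MeasurePreserving (star : ℍ → ℍ) volume volume :=
    starIsometry.measurePreserving
  rw [lintegral_map hf hm, lintegral_gaussMeasure (f := fun q => f (star q)) (hf.comp hm), lintegral_gaussMeasure hf,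
    ← hv.lintegral_comp (f := fun q : ℍ => ENNReal.ofReal (Real.exp (-‖q‖ ^ 2)) * f q)
      ((by fun_prop : Measurable fun q : ℍ => ENNReal.ofReal (Real.exp (-‖q‖ ^ 2))).mul hf)]
  simp only [norm_star]

lemma integral_gaussMeasure {E : Type*} [NormedAddCommGroup E] [NormedSpace ℝ E] (f : ℍ → E) :
    ∫ q, f q ∂gaussMeasure = ∫ q, Real.exp (-‖q‖ ^ 2) • f q := by
  rw [gaussMeasure, integral_withDensity_eq_integral_toReal_smul (by fun_prop) (by simp)]
  simp only [ENNReal.toReal_ofReal (Real.exp_pos _).le]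

lemma integral_re_norm_im {E : Type*} [NormedAddCommGroup E] [NormedSpace ℝ E] (h : ℝ × ℝ → E)
    (hh : StronglyMeasurable h) :
    ∫ q : ℍ, h (q.re, ‖q.im‖) = ∫ x in univ ×ˢ Ioi 0, (4 * Real.pi * x.2 ^ 2) • h x := by
  have hm : Measurable fun q : ℍ => (q.re, ‖q.im‖) := by
    refine Quaternion.continuous_re.measurable.prodMk ?_
    exact Quaternion.continuous_im.norm.measurable
  rw [← integral_map (f := h) hm.aemeasurable hh.aestronglyMeasurable, map_re_norm_im,
    integral_withDensity_eq_integral_toReal_smul (by fun_prop) (by simp)]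
  refine integral_congr_ae (Filter.Eventually.of_forall fun x => ?_)
  simp only
  rw [ENNReal.toReal_ofReal (by positivity)]

lemma integral_halfPlane_polar {E : Type*} [NormedAddCommGroup E] [NormedSpace ℝ E]
    (h : ℝ × ℝ → E) :
    ∫ x in univ ×ˢ Ioi 0, h x =
      ∫ x in Ioi 0 ×ˢ Ioo 0 Real.pi, x.1 • h (x.1 * Real.cos x.2, x.1 * Real.sin x.2) := by
  have hs : MeasurableSet (univ ×ˢ Ioi 0 : Set (ℝ × ℝ)) := MeasurableSet.univ.prod measurableSet_Ioi
  rw [← integral_indicator hs, ← integral_comp_polarCoord_symm]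
  have e : ∀ p ∈ polarCoord.target, p.1 • (univ ×ˢ Ioi 0).indicator h (polarCoord.symm p) =
      (univ ×ˢ Ioi 0).indicator (fun x : ℝ × ℝ => x.1 • h (x.1 * Real.cos x.2, x.1 * Real.sin x.2))
        p := by
    rintro ⟨r, θ⟩ ⟨hr, hθ⟩
    simp only [mem_Ioi, mem_Ioo] at hr hθ
    rw [polarCoord_symm_apply]
    by_cases h0 : 0 < θ
    · have : 0 < r * Real.sin θ := mul_pos hr (Real.sin_pos_of_pos_of_lt_pi h0 hθ.2)
      rw [indicator_of_mem (by simpa using this), indicator_of_mem (by simpa using h0)]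
    · have : r * Real.sin θ ≤ 0 := mul_nonpos_of_nonneg_of_nonpos hr.le
        (Real.sin_nonpos_of_nonpos_of_neg_pi_le (not_lt.1 h0) hθ.1.le)
      rw [indicator_of_notMem (by simpa using this), indicator_of_notMem (by simpa using h0),
        smul_zero]
  rw [setIntegral_congr_fun polarCoord.open_target.measurableSet e, setIntegral_indicator hs]
  congr 2
  ext ⟨r, θ⟩
  simp only [polarCoord, mem_inter_iff, mem_prod, mem_Ioi, mem_Ioo, mem_univ, true_and]
  have := Real.pi_pos
  constructor
  · rintro ⟨⟨a, b⟩, c⟩; exact ⟨a, c, b.2⟩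
  · rintro ⟨a, b, c⟩; exact ⟨⟨a, by linarith, c⟩, b⟩

lemma integral_pow_radialMeasure (k : ℕ) : ∫ r : Ioi (0 : ℝ), (r : ℝ) ^ k ∂radialMeasure =
    ∫ r in Ioi (0 : ℝ), r ^ (3 + k) * Real.exp (-r ^ 2) := by
  rw [integral_eq_lintegral_of_nonneg_ae
    (Filter.Eventually.of_forall fun r => pow_nonneg (le_of_lt r.2) k)
    (by fun_prop), lintegral_radialMeasure (F := fun r => ENNReal.ofReal (r ^ k)) (by fun_prop),
    integral_eq_lintegral_of_nonneg_ae _ (by fun_prop)]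
  · congr 1
    refine setLIntegral_congr_fun measurableSet_Ioi fun r hr => ?_
    have hr : 0 < r := hr
    rw [← ENNReal.ofReal_mul (by positivity)]
    congr 1
    ring
  · filter_upwards [ae_restrict_mem measurableSet_Ioi] with r hr
    have hr : 0 < r := hr
    simp only [Pi.zero_apply]
    positivity

lemma integral_pow_radialMeasure_pos (k : ℕ) :
    0 < ∫ r : Ioi (0 : ℝ), (r : ℝ) ^ k ∂radialMeasure := by
  have h := integral_rpow_mul_exp_neg_rpow (p := 2) (q := (3 + k : ℕ)) (by norm_num)
    (by have : (0 : ℝ) ≤ (3 + k : ℕ) := by positivity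
        linarith)
  rw [integral_pow_radialMeasure]
  simp only [Real.rpow_natCast, Real.rpow_two] at h
  rw [h]
  exact mul_pos (by norm_num) (Real.Gamma_pos_of_pos (by positivity))

/-- Homogeneity separates the radial factor. Used with the identity and the real part, this trades
sphere integrals for Gaussian ones, which the half plane coordinates compute. -/
lemma integral_pow_gaussMeasure {E : Type*} [NormedAddCommGroup E] [NormedSpace ℝ E] (k : ℕ)
    (L : ℍ → E) (hL : Continuous L) (hs : ∀ (r : ℝ) q, L (r • q) = r • L q) :
    ∫ q, L (q ^ k) ∂gaussMeasure =
      (∫ r : Ioi (0 : ℝ), (r : ℝ) ^ k ∂radialMeasure) • ∫ ω : USphere, L ((ω : ℍ) ^ k) ∂sphereMeasure := by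
  rw [← integral_prod_smul, ← measurePreserving_polarMap.map_eq, integral_map
    measurable_polarMap.aemeasurable]
  · simp only [polarMap, smul_pow, hs]
  · exact (hL.comp (continuous_pow k)).aestronglyMeasurable

lemma integral_re_pow_gaussMeasure (k : ℕ) :
    ∫ q : ℍ, (q ^ k).re ∂gaussMeasure =
      (∫ r : Ioi (0 : ℝ), (r : ℝ) ^ k ∂radialMeasure) * sphereMoment k := by
  have e : ∀ q : ℍ, Real.exp (-‖q‖ ^ 2) • (q ^ k).re = (fun x : ℝ × ℝ =>
      Real.exp (-(x.1 ^ 2 + x.2 ^ 2)) * (((x.1 : ℂ) + x.2 * Complex.I) ^ k).re) (q.re, ‖q.im‖) := by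
    intro q
    have h := norm_sq_eq q
    have h' := norm_im_sq_eq q
    simp only [re_pow_eq, smul_eq_mul, h, h', add_assoc]
  rw [integral_gaussMeasure, integral_congr_ae (Filter.Eventually.of_forall e),
    integral_re_norm_im (fun x : ℝ × ℝ =>
      Real.exp (-(x.1 ^ 2 + x.2 ^ 2)) * (((x.1 : ℂ) + x.2 * Complex.I) ^ k).re)
      (Continuous.stronglyMeasurable (by fun_prop)), integral_halfPlane_polar, integral_pow_radialMeasure,
    ← integral_sin_sq_mul_cos, intervalIntegral.integral_of_le Real.pi_pos.le,
    integral_Ioc_eq_integral_Ioo, mul_left_comm, Measure.volume_eq_prod,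
    ← setIntegral_prod_mul, ← integral_const_mul]
  refine integral_congr_ae (Filter.Eventually.of_forall fun x => ?_)
  have h1 : ((x.1 * Real.cos x.2 : ℝ) : ℂ) + (x.1 * Real.sin x.2 : ℝ) * Complex.I =
      x.1 * (Complex.cos x.2 + Complex.sin x.2 * Complex.I) := by
    push_cast
    ring
  have h2 : (x.1 * Real.cos x.2) ^ 2 + (x.1 * Real.sin x.2) ^ 2 = x.1 ^ 2 := by
    rw [mul_pow, mul_pow, ← mul_add, Real.cos_sq_add_sin_sq, mul_one]
  have h3 : ((x.1 * (Complex.cos x.2 + Complex.sin x.2 * Complex.I)) ^ k).re =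
      x.1 ^ k * Real.cos (k * x.2) := by
    rw [mul_pow, Complex.cos_add_sin_mul_I_pow, ← Complex.ofReal_pow, Complex.re_ofReal_mul]
    congr 1
    have : (k : ℂ) * x.2 = ((k * x.2 : ℝ) : ℂ) := by push_cast; rfl
    rw [this, ← Complex.ofReal_cos, ← Complex.ofReal_sin, Complex.add_re, Complex.re_ofReal_mul,
      Complex.I_re, mul_zero, add_zero, Complex.ofReal_re]
  simp only [h1, h2, h3, smul_eq_mul]
  push_cast
  ring

/-- Conjugation preserves the Gaussian measure and commutes with powers, so the integral is real.
Its real part follows from two evaluations of the Gaussian moment, divided by the positive radial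
moment. -/
lemma integral_pow_sphere (k : ℕ) :
    ∫ ω : USphere, (ω : ℍ) ^ k ∂sphereMeasure = ((sphereMoment k : ℝ) : ℍ) := by
  have hR := (integral_pow_radialMeasure_pos k).ne'
  have hJ := integral_pow_gaussMeasure k id continuous_id fun _ _ => rfl
  have hre := integral_pow_gaussMeasure k (fun q : ℍ => q.re) Quaternion.continuous_re
    fun _ _ => rfl
  simp only [id] at hJ
  rw [integral_re_pow_gaussMeasure, smul_eq_mul] at hre
  have hre := mul_left_cancel₀ hR hre
  have hint : Integrable (fun ω : USphere => (ω : ℍ) ^ k) sphereMeasure := by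
    refine Integrable.of_bound (by fun_prop) 1 (Filter.Eventually.of_forall fun ω => ?_)
    rw [norm_pow, norm_coe_uSphere, one_pow]
  rw [← re_integral hint] at hre
  have hst : star (∫ q : ℍ, q ^ k ∂gaussMeasure) = ∫ q : ℍ, q ^ k ∂gaussMeasure := by
    rw [← integral_star]
    simp only [star_pow]
    exact measurePreserving_star.integral_comp
      starIsometry.toHomeomorph.measurableEmbedding fun q => q ^ k
  rw [hJ, star_real_smul] at hst
  have hst := smul_right_injective ℍ hR hst
  rw [hre]
  exact Quaternion.star_eq_self.1 hst

lemma star_coe_uSphere (ω : USphere) : star (ω : ℍ) = (ω : ℍ)⁻¹ := by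
  rw [Quaternion.inv_def, Quaternion.normSq_eq_norm_mul_self, norm_coe_uSphere]
  simp

lemma star_zpow_uSphere (ω : USphere) (k : ℤ) : star ((ω : ℍ) ^ k) = (ω : ℍ) ^ (-k) := by
  rw [star_zpow₀, star_coe_uSphere, inv_zpow, zpow_neg]

lemma norm_zpow_uSphere (ω : USphere) (k : ℤ) : ‖(ω : ℍ) ^ k‖ = 1 := by
  rw [norm_zpow, norm_coe_uSphere, one_zpow]

lemma sphereMoment_neg (k : ℤ) : sphereMoment (-k) = sphereMoment k := by
  unfold sphereMoment
  split_ifs <;> first | rfl | omega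

lemma integral_zpow_sphere (k : ℤ) :
    ∫ ω : USphere, (ω : ℍ) ^ k ∂sphereMeasure = ((sphereMoment k : ℝ) : ℍ) := by
  obtain ⟨n, rfl | rfl⟩ := k.eq_nat_or_neg
  · simpa using integral_pow_sphere n
  · have h := integral_star (μ := sphereMeasure) fun ω : USphere => (ω : ℍ) ^ (n : ℤ)
    simp only [star_zpow_uSphere] at h
    rw [h, sphereMoment_neg]
    simp [integral_pow_sphere n]

/-! ### Polar coordinates -/
/-! ### Fourier coefficients on the unit sphere -/

lemma continuous_zpow_uSphere (m : ℤ) : Continuous fun ω : USphere => (ω : ℍ) ^ m :=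
  continuous_subtype_val.zpow₀ m fun ω => Or.inl (coe_uSphere_ne_zero ω)

/-- The Fourier coefficients of a function on the unit sphere with respect to the powers. -/
def sphereCoeff (m : ℤ) (f : USphere → ℍ) : ℍ :=
  ∫ ω : USphere, (ω : ℍ) ^ (-m) * f ω ∂sphereMeasure

lemma integrable_zpow_mul {f : USphere → ℍ} (hf : Integrable f sphereMeasure) (m : ℤ) :
    Integrable (fun ω : USphere => (ω : ℍ) ^ m * f ω) sphereMeasure :=
  hf.bdd_mul (c := 1) (continuous_zpow_uSphere m).aestronglyMeasurable
    (Filter.Eventually.of_forall fun ω => (norm_zpow_uSphere ω m).le)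

lemma integrable_zpow (m : ℤ) : Integrable (fun ω : USphere => (ω : ℍ) ^ m) sphereMeasure :=
  Integrable.of_bound (continuous_zpow_uSphere m).aestronglyMeasurable 1
    (Filter.Eventually.of_forall fun ω => (norm_zpow_uSphere ω m).le)

lemma abs_sphereMoment (n m : ℤ) : |sphereMoment (n - m)| =
    (if n = m then 2 * Real.pi ^ 2 else 0) + (if n = m + 2 then Real.pi ^ 2 else 0) +
      (if n = m - 2 then Real.pi ^ 2 else 0) := by
  have h := sq_nonneg Real.pi
  unfold sphereMoment
  split_ifs <;> first | omega | simp [abs_of_nonneg, h]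

lemma sum_abs_sphereMoment_le (F : Finset ℤ) (m : ℤ) :
    ∑ n ∈ F, |sphereMoment (n - m)| ≤ 4 * Real.pi ^ 2 := by
  have h := sq_nonneg Real.pi
  simp only [abs_sphereMoment, Finset.sum_add_distrib, Finset.sum_ite_eq']
  split_ifs <;> linarith

/-- The Schur test for the Gram matrix of the powers: it is symmetric, with absolute row sums at
most 2π² + π² + π². -/
lemma sum_sphereMoment_le (F : Finset ℤ) (c : ℤ → ℍ) :
    ∑ m ∈ F, ∑ n ∈ F, sphereMoment (n - m) * (star (c m) * c n).re ≤
      4 * Real.pi ^ 2 * ∑ m ∈ F, ‖c m‖ ^ 2 := by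
  have h1 : ∀ m n, sphereMoment (n - m) * (star (c m) * c n).re ≤
      |sphereMoment (n - m)| * ‖c m‖ ^ 2 / 2 + |sphereMoment (n - m)| * ‖c n‖ ^ 2 / 2 := by
    intro m n
    have e : |(star (c m) * c n).re| ≤ ‖c m‖ * ‖c n‖ := by
      rw [← inner_eq_re]
      exact abs_real_inner_le_norm _ _
    have e2 : ‖c m‖ * ‖c n‖ ≤ (‖c m‖ ^ 2 + ‖c n‖ ^ 2) / 2 := by
      nlinarith [sq_nonneg (‖c m‖ - ‖c n‖)]
    calc sphereMoment (n - m) * (star (c m) * c n).re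
        ≤ |sphereMoment (n - m) * (star (c m) * c n).re| := le_abs_self _
      _ = |sphereMoment (n - m)| * |(star (c m) * c n).re| := abs_mul _ _
      _ ≤ |sphereMoment (n - m)| * ((‖c m‖ ^ 2 + ‖c n‖ ^ 2) / 2) := by
          gcongr
          exact e.trans e2
      _ = _ := by ring
  have h2 : ∑ m ∈ F, ∑ n ∈ F, |sphereMoment (n - m)| * ‖c m‖ ^ 2 / 2 ≤
      2 * Real.pi ^ 2 * ∑ m ∈ F, ‖c m‖ ^ 2 := by
    rw [Finset.mul_sum]
    refine Finset.sum_le_sum fun m _ => ?_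
    rw [← Finset.sum_div, ← Finset.sum_mul]
    nlinarith [sum_abs_sphereMoment_le F m, sq_nonneg ‖c m‖]
  have h3 : ∑ m ∈ F, ∑ n ∈ F, |sphereMoment (n - m)| * ‖c n‖ ^ 2 / 2 =
      ∑ m ∈ F, ∑ n ∈ F, |sphereMoment (n - m)| * ‖c m‖ ^ 2 / 2 := by
    rw [Finset.sum_comm]
    refine Finset.sum_congr rfl fun m _ => Finset.sum_congr rfl fun n _ => ?_
    rw [← sphereMoment_neg, neg_sub]
  calc _ ≤ ∑ m ∈ F, ∑ n ∈ F, (|sphereMoment (n - m)| * ‖c m‖ ^ 2 / 2 +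
        |sphereMoment (n - m)| * ‖c n‖ ^ 2 / 2) :=
        Finset.sum_le_sum fun m _ => Finset.sum_le_sum fun n _ => h1 m n
    _ ≤ _ := by
        simp only [Finset.sum_add_distrib]
        rw [h3]
        linarith

lemma integral_re_star_mul_zpow_mul (c d : ℍ) (m n : ℤ) :
    ∫ ω : USphere, (star ((ω : ℍ) ^ m * c) * ((ω : ℍ) ^ n * d)).re ∂sphereMeasure =
      sphereMoment (n - m) * (star c * d).re := by
  have e : ∀ ω : USphere, star ((ω : ℍ) ^ m * c) * ((ω : ℍ) ^ n * d) =
      star c * (ω : ℍ) ^ (n - m) * d := by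
    intro ω
    rw [star_mul, star_zpow_uSphere, sub_eq_neg_add, zpow_add₀ (coe_uSphere_ne_zero ω)]
    noncomm_ring
  have hi := integrable_zpow (n - m)
  simp only [e]
  rw [← re_integral ((hi.const_mul _).mul_const _),
    integral_mul_const_of_integrable (hi.const_mul _), integral_const_mul_of_integrable hi,
    integral_zpow_sphere, ← Quaternion.coe_commutes, mul_assoc, Quaternion.coe_mul_eq_smul]
  rfl

/-- Bessel's inequality for the powers on the unit sphere. -/
lemma sum_norm_sphereCoeff_sq_le {f : USphere → ℍ} (hf : MemLp f 2 sphereMeasure) (F : Finset ℤ) :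
    ∑ m ∈ F, ‖sphereCoeff m f‖ ^ 2 ≤ 4 * Real.pi ^ 2 * ∫ ω, ‖f ω‖ ^ 2 ∂sphereMeasure := by
  have hf1 : Integrable f sphereMeasure := hf.integrable (by norm_num)
  set c : ℤ → ℍ := fun m => sphereCoeff m f with hc
  set A := ∑ m ∈ F, ‖c m‖ ^ 2 with hA
  -- Integrating ‖f - t ∑ ω^m c_m‖² ≥ 0 gives 0 ≤ ‖f‖² - 2 t A + 4π² t² A, and this `t` minimises
  -- the right side.
  set t : ℝ := 1 / (4 * Real.pi ^ 2) with ht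
  have hpi := Real.pi_pos
  have hexp : ∀ ω : USphere, ‖f ω - t • ∑ m ∈ F, (ω : ℍ) ^ m * c m‖ ^ 2 =
      ‖f ω‖ ^ 2 - 2 * t * (∑ m ∈ F, (star (c m) * ((ω : ℍ) ^ (-m) * f ω)).re) +
      t ^ 2 * ∑ m ∈ F, ∑ n ∈ F, (star ((ω : ℍ) ^ m * c m) * ((ω : ℍ) ^ n * c n)).re := by
    intro ω
    have e1 : ∀ m, (star (c m) * ((ω : ℍ) ^ (-m) * f ω)).re = ⟪(ω : ℍ) ^ m * c m, f ω⟫ := by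
      intro m
      rw [inner_eq_re, star_mul, star_zpow_uSphere, mul_assoc]
    simp only [e1, ← inner_eq_re]
    rw [norm_sub_sq_real, real_inner_smul_right, ← sum_inner, norm_smul, mul_pow,
      ← real_inner_self_eq_norm_sq (∑ m ∈ F, (ω : ℍ) ^ m * c m), sum_inner, Real.norm_eq_abs,
      sq_abs, real_inner_comm]
    simp only [inner_sum]
    ring
  have i1 : ∀ m, Integrable (fun ω : USphere => star (c m) * ((ω : ℍ) ^ (-m) * f ω))
      sphereMeasure := fun m => (integrable_zpow_mul hf1 _).const_mul _
  have i2 : ∀ m n, Integrable (fun ω : USphere =>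
      (star ((ω : ℍ) ^ m * c m) * ((ω : ℍ) ^ n * c n)).re) sphereMeasure := by
    intro m n
    refine Integrable.of_bound (Continuous.aestronglyMeasurable ?_) (‖c m‖ * ‖c n‖)
      (Filter.Eventually.of_forall fun ω => ?_)
    · exact Quaternion.continuous_re.comp
        ((((continuous_zpow_uSphere m).mul continuous_const).star).mul
          ((continuous_zpow_uSphere n).mul continuous_const))
    · rw [← inner_eq_re]
      refine (abs_real_inner_le_norm _ _).trans_eq ?_
      rw [norm_mul, norm_mul, norm_zpow_uSphere, norm_zpow_uSphere, one_mul, one_mul]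
  have i3 : ∀ m, Integrable (fun ω : USphere => (star (c m) * ((ω : ℍ) ^ (-m) * f ω)).re)
      sphereMeasure := by
    intro m
    have := (innerSL ℝ (1 : ℍ)).integrable_comp (i1 m)
    simpa [inner_eq_re] using this
  have j1 : ∀ m, ∫ ω : USphere, (star (c m) * ((ω : ℍ) ^ (-m) * f ω)).re ∂sphereMeasure =
      ‖c m‖ ^ 2 := by
    intro m
    rw [← re_integral (i1 m), integral_const_mul_of_integrable (integrable_zpow_mul hf1 _),
      ← real_inner_self_eq_norm_sq, inner_eq_re]
    rfl
  have hf2 : Integrable (fun ω => ‖f ω‖ ^ 2) sphereMeasure :=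
    (memLp_two_iff_integrable_sq_norm hf.1).1 hf
  have h0 : 0 ≤ ∫ ω : USphere, ‖f ω - t • ∑ m ∈ F, (ω : ℍ) ^ m * c m‖ ^ 2 ∂sphereMeasure :=
    integral_nonneg fun ω => by positivity
  simp only [hexp] at h0
  have k1 : Integrable (fun ω : USphere => 2 * t *
      ∑ m ∈ F, (star (c m) * ((ω : ℍ) ^ (-m) * f ω)).re) sphereMeasure :=
    (integrable_finsetSum _ fun m _ => i3 m).const_mul _
  have k2 : Integrable (fun ω : USphere => t ^ 2 * ∑ m ∈ F, ∑ n ∈ F,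
      (star ((ω : ℍ) ^ m * c m) * ((ω : ℍ) ^ n * c n)).re) sphereMeasure :=
    (integrable_finsetSum _ fun m _ => integrable_finsetSum _ fun n _ => i2 m n).const_mul _
  have k3 : Integrable (fun ω : USphere => ‖f ω‖ ^ 2 - 2 * t *
      ∑ m ∈ F, (star (c m) * ((ω : ℍ) ^ (-m) * f ω)).re) sphereMeasure := hf2.sub k1
  rw [integral_add k3 k2, integral_sub hf2 k1, integral_const_mul, integral_const_mul,
    integral_finsetSum _ fun m _ => i3 m,
    integral_finsetSum _ fun m _ => integrable_finsetSum _ fun n _ => i2 m n] at h0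
  simp only [integral_finsetSum _ fun n _ => i2 _ n, j1, integral_re_star_mul_zpow_mul] at h0
  have h1 := sum_sphereMoment_le F c
  rw [← hA] at h0 h1
  have h2 : t ^ 2 * (∑ m ∈ F, ∑ n ∈ F, sphereMoment (n - m) * (star (c m) * c n).re) ≤ t * A := by
    calc _ ≤ t ^ 2 * (4 * Real.pi ^ 2 * A) := by gcongr
      _ = t * A := by rw [ht]; field_simp
  have h3 : t * A ≤ ∫ ω, ‖f ω‖ ^ 2 ∂sphereMeasure := by linarith
  rw [ht, one_div, inv_mul_le_iff₀ (by positivity)] at h3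
  exact h3

lemma tsum_enorm_sphereCoeff_sq_le {f : USphere → ℍ} (hf : AEStronglyMeasurable f sphereMeasure) :
    ∑' m, ‖sphereCoeff m f‖ₑ ^ 2 ≤
      ENNReal.ofReal (4 * Real.pi ^ 2) * ∫⁻ ω, ‖f ω‖ₑ ^ 2 ∂sphereMeasure := by
  by_cases h : ∫⁻ ω, ‖f ω‖ₑ ^ 2 ∂sphereMeasure = ∞
  · rw [h, ENNReal.mul_top (by simp [Real.pi_ne_zero])]
    exact le_top
  have hm : MemLp f 2 sphereMeasure := by
    refine ⟨hf, ?_⟩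
    rw [← eLpNorm_two_sq] at h
    exact lt_top_iff_ne_top.2 fun h' => h (by rw [h']; simp)
  refine ENNReal.summable.tsum_le_of_sum_le fun F => ?_
  have h1 := ENNReal.ofReal_le_ofReal (sum_norm_sphereCoeff_sq_le hm F)
  rw [ENNReal.ofReal_mul (by positivity), ENNReal.ofReal_sum_of_nonneg fun _ _ => by positivity,
    ofReal_integral_eq_lintegral_ofReal ((memLp_two_iff_integrable_sq_norm hf).1 hm)
      (Filter.Eventually.of_forall fun _ => by positivity)] at h1
  simpa only [ENNReal.ofReal_pow (norm_nonneg _), ofReal_norm] using h1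

/-! ### Polar coordinates -/
/-! ### The Cauchy kernel on pairs of spheres -/

lemma integral_prod_mul_quaternion {α β : Type*} [MeasurableSpace α] [MeasurableSpace β]
    {μ : Measure α} {ν : Measure β} [SFinite μ] [SFinite ν] {G : α → ℍ} {H : β → ℍ}
    (hG : Integrable G μ) (hH : Integrable H ν) :
    ∫ x, G x.1 * H x.2 ∂μ.prod ν = (∫ x, G x ∂μ) * ∫ y, H y ∂ν := by
  rw [integral_prod _ (hG.mul_prod hH)]
  simp only [integral_const_mul_of_integrable hH]
  rw [integral_mul_const_of_integrable hG]

/-- Each term of the expansion separates the variables, so its integral is the product of a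
conjugated coefficient of `g` and a coefficient of `f`. Summability of `a` justifies integrating
term by term, because the powers have norm 1 on the sphere. -/
lemma enorm_integral_star_mul_mul_le {f g : USphere → ℍ} (hf : Integrable f sphereMeasure)
    (hg : Integrable g sphereMeasure) {a : ℕ → ℝ} (ha : Summable fun n => |a n|) (m l : ℕ → ℤ)
    {K : USphere × USphere → ℍ}
    (hK : ∀ x, HasSum (fun n => a n • ((x.1 : ℍ) ^ m n * (x.2 : ℍ) ^ (-l n))) (K x)) :
    ‖∫ x, star (g x.1) * K x * f x.2 ∂sphereMeasure.prod sphereMeasure‖ₑ ≤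
      ∑' n, ‖a n‖ₑ * (‖sphereCoeff (m n) g‖ₑ * ‖sphereCoeff (l n) f‖ₑ) := by
  set G : ℕ → USphere → ℍ := fun n ω => star ((ω : ℍ) ^ (-m n) * g ω) with hG
  set H : ℕ → USphere → ℍ := fun n η => (η : ℍ) ^ (-l n) * f η with hH
  have iG : ∀ n, Integrable (G n) sphereMeasure := fun n =>
    starIsometry.toContinuousLinearEquiv.toContinuousLinearMap.integrable_comp
      (integrable_zpow_mul hg _)
  have iH : ∀ n, Integrable (H n) sphereMeasure := fun n => integrable_zpow_mul hf _
  have hsum : ∀ x : USphere × USphere, HasSum (fun n => a n • (G n x.1 * H n x.2))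
      (star (g x.1) * K x * f x.2) := by
    intro x
    refine (((hK x).mul_left (star (g x.1))).mul_right (f x.2)).congr_fun ?_
    intro n
    simp only [hG, hH, star_mul, star_zpow_uSphere, neg_neg, mul_smul_comm, smul_mul_assoc,
      mul_assoc]
  have hint : ∀ n, Integrable (fun x : USphere × USphere => a n • (G n x.1 * H n x.2))
      (sphereMeasure.prod sphereMeasure) := fun n => ((iG n).mul_prod (iH n)).smul (a n)
  have hnorm : ∀ n, ∫ x : USphere × USphere, ‖a n • (G n x.1 * H n x.2)‖
      ∂sphereMeasure.prod sphereMeasure =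
      |a n| * ((∫ ω, ‖g ω‖ ∂sphereMeasure) * ∫ ω, ‖f ω‖ ∂sphereMeasure) := by
    intro n
    rw [← integral_prod_mul, ← integral_const_mul]
    simp only [hG, hH, norm_smul, norm_mul, norm_star, norm_zpow_uSphere, one_mul, Real.norm_eq_abs]
  have h := hasSum_integral_of_summable_integral_norm hint
    (by simp only [hnorm]; exact ha.mul_right _)
  simp only [fun x => (hsum x).tsum_eq] at h
  rw [← h.tsum_eq]
  refine enorm_tsum_le_tsum_enorm.trans_eq (tsum_congr fun n => ?_)
  rw [integral_smul, integral_prod_mul_quaternion (iG n) (iH n), enorm_smul, enorm_mul]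
  simp only [hG, integral_star]
  rw [← ofReal_norm (star _), norm_star, ofReal_norm]
  rfl

lemma enorm_integral_cauchyKernel_le_of_lt {f g : USphere → ℍ} (hf : Integrable f sphereMeasure)
    (hg : Integrable g sphereMeasure) {r s : ℝ} (hs : 0 < s) (hr : s < r) :
    ‖∫ x, star (g x.1) * cauchyKernel (r • (x.1 : ℍ)) (s • (x.2 : ℍ)) * f x.2
        ∂sphereMeasure.prod sphereMeasure‖ₑ ≤
      ∑' n : ℕ, ENNReal.ofReal r⁻¹ *
        (‖sphereCoeff (-(n + 1)) g‖ₑ * ‖sphereCoeff (-n) f‖ₑ) := by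
  have h0 : 0 < r := hs.trans hr
  have hq : |s / r| < 1 := by rwa [abs_of_pos (by positivity), div_lt_one h0]
  have hsr : s / r ≤ 1 := (div_le_one h0).2 hr.le
  have ha : ∀ n : ℕ, 0 ≤ r⁻¹ * (s / r) ^ n := fun n => by positivity
  refine (enorm_integral_star_mul_mul_le hf hg (a := fun n => r⁻¹ * (s / r) ^ n) ?_
    (fun n => -(n + 1)) (fun n => -n) fun x => ?_).trans ?_
  · simp only [fun n => abs_of_nonneg (ha n)]
    exact (summable_geometric_of_abs_lt_one hq).mul_left _
  · have h := hasSum_cauchyKernel_of_norm_lt (q := r • (x.1 : ℍ)) (p := s • (x.2 : ℍ)) (by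
      rw [norm_smul, norm_smul, norm_coe_uSphere, norm_coe_uSphere, mul_one, mul_one,
        Real.norm_of_nonneg hs.le, Real.norm_of_nonneg h0.le]
      exact hr)
    refine h.congr_fun fun n => ?_
    have e1 : (x.1 : ℍ) ^ (-((n : ℤ) + 1)) = (x.1 : ℍ)⁻¹ ^ (n + 1) := by
      rw [zpow_neg, inv_pow]
      norm_cast
    rw [e1, neg_neg, zpow_natCast, smul_inv₀, smul_pow, smul_pow, smul_mul_smul_comm]
    congr 1
    rw [div_pow, inv_pow, pow_succ]
    field_simp
  -- Bounding (s/r)^n by 1 leaves the same radial factor 1/r for all `n`.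
  · refine ENNReal.tsum_le_tsum fun n => ?_
    gcongr
    rw [← ofReal_norm, Real.norm_of_nonneg (ha n)]
    exact ENNReal.ofReal_le_ofReal
      (mul_le_of_le_one_right (by positivity) (pow_le_one₀ (by positivity) hsr))

lemma enorm_integral_cauchyKernel_le_of_gt {f g : USphere → ℍ} (hf : Integrable f sphereMeasure)
    (hg : Integrable g sphereMeasure) {r s : ℝ} (hr : 0 < r) (hs : r < s) :
    ‖∫ x, star (g x.1) * cauchyKernel (r • (x.1 : ℍ)) (s • (x.2 : ℍ)) * f x.2
        ∂sphereMeasure.prod sphereMeasure‖ₑ ≤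
      ∑' n : ℕ, ENNReal.ofReal s⁻¹ * (‖sphereCoeff n g‖ₑ * ‖sphereCoeff (n + 1) f‖ₑ) := by
  have h0 : 0 < s := hr.trans hs
  have hq : |r / s| < 1 := by rwa [abs_of_pos (by positivity), div_lt_one h0]
  have hsr : r / s ≤ 1 := (div_le_one h0).2 hs.le
  have ha : ∀ n : ℕ, 0 ≤ s⁻¹ * (r / s) ^ n := fun n => by positivity
  refine (enorm_integral_star_mul_mul_le hf hg (a := fun n => -(s⁻¹ * (r / s) ^ n)) ?_
    (fun n => n) (fun n => n + 1) fun x => ?_).trans ?_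
  · simp only [abs_neg, fun n => abs_of_nonneg (ha n)]
    exact (summable_geometric_of_abs_lt_one hq).mul_left _
  · have h := hasSum_cauchyKernel_of_lt_norm (q := r • (x.1 : ℍ)) (p := s • (x.2 : ℍ)) (by
      rw [norm_smul, norm_smul, norm_coe_uSphere, norm_coe_uSphere, mul_one, mul_one,
        Real.norm_of_nonneg hr.le, Real.norm_of_nonneg h0.le]
      exact hs)
    refine h.congr_fun fun n => ?_
    have e1 : (x.2 : ℍ) ^ (-((n : ℤ) + 1)) = (x.2 : ℍ)⁻¹ ^ (n + 1) := by
      rw [zpow_neg, inv_pow]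
      norm_cast
    rw [e1, zpow_natCast, smul_inv₀, smul_pow, smul_pow, smul_mul_smul_comm, neg_smul]
    congr 2
    rw [div_pow, inv_pow, pow_succ]
    field_simp
  · refine ENNReal.tsum_le_tsum fun n => ?_
    gcongr
    rw [enorm_neg, ← ofReal_norm, Real.norm_of_nonneg (ha n)]
    exact ENNReal.ofReal_le_ofReal
      (mul_le_of_le_one_right (by positivity) (pow_le_one₀ (by positivity) hsr))

/-! ### Polar coordinates -/
/-! ### The radial Hilbert–Schmidt estimate -/

/-- The radial bound for the Cauchy kernel on a pair of spheres. -/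
def radialKernel (x : Ioi (0 : ℝ) × Ioi (0 : ℝ)) : ℝ≥0∞ :=
  {x : Ioi (0 : ℝ) × Ioi (0 : ℝ) | x.2 < x.1}.indicator (fun x => ENNReal.ofReal (x.1 : ℝ)⁻¹) x

lemma measurable_radialKernel : Measurable radialKernel := by
  have h : Measurable fun x : Ioi (0 : ℝ) × Ioi (0 : ℝ) => ENNReal.ofReal (x.1 : ℝ)⁻¹ := by fun_prop
  exact h.indicator (measurableSet_lt measurable_snd measurable_fst)

lemma lintegral_Ioi_mul_exp (s : ℝ) (hs : 0 < s) :
    ∫⁻ r in Ioi s, ENNReal.ofReal (r * Real.exp (-r ^ 2)) =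
      ENNReal.ofReal (Real.exp (-s ^ 2) / 2) := by
  have hd : ∀ x ∈ Ici s, HasDerivAt (fun r : ℝ => -(Real.exp (-r ^ 2) / 2))
      (x * Real.exp (-x ^ 2)) x := by
    intro x _
    refine (((hasDerivAt_pow 2 x).fun_neg.exp).div_const 2).fun_neg.congr_deriv ?_
    push_cast
    ring
  have hn : ∀ x ∈ Ioi s, 0 ≤ x * Real.exp (-x ^ 2) := fun x hx =>
    mul_nonneg (hs.trans hx).le (Real.exp_pos _).le
  have hl : Filter.Tendsto (fun r : ℝ => -(Real.exp (-r ^ 2) / 2)) Filter.atTop (nhds 0) := by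
    have : Filter.Tendsto (fun r : ℝ => Real.exp (-r ^ 2)) Filter.atTop (nhds 0) :=
      Real.tendsto_exp_neg_atTop_nhds_zero.comp (Filter.tendsto_pow_atTop two_ne_zero)
    simpa using (this.div_const 2).neg
  rw [← ofReal_integral_eq_lintegral_ofReal (integrableOn_Ioi_deriv_of_nonneg' hd hn hl)
    ((ae_restrict_mem measurableSet_Ioi).mono hn), integral_Ioi_of_hasDerivAt_of_nonneg' hd hn hl]
  simp

/-- The weight r³ cancels r⁻² down to r. Integrating over r > s leaves exp(-s²)/2, and half of ∫ s³
exp(-2s²) ds = 1/8 remains. -/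
lemma lintegral_sq_radialKernel :
    ∫⁻ x, radialKernel x ^ 2 ∂radialMeasure.prod radialMeasure = ENNReal.ofReal (1 / 16) := by
  have h1 : ∀ s : Ioi (0 : ℝ), ∫⁻ r, radialKernel (r, s) ^ 2 ∂radialMeasure =
      ENNReal.ofReal (Real.exp (-(s : ℝ) ^ 2) / 2) := by
    intro s
    have hs : (0 : ℝ) < s := s.2
    have hm : Measurable fun r : ℝ => ENNReal.ofReal r⁻¹ ^ 2 := by fun_prop
    have e : ∀ r : Ioi (0 : ℝ), radialKernel (r, s) ^ 2 =
        (Ioi (s : ℝ)).indicator (fun r => ENNReal.ofReal r⁻¹ ^ 2) r := by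
      intro r
      by_cases h : s < r
      · have h' : (s : ℝ) < r := h
        simp [radialKernel, h, h']
      · have h' : ¬ (s : ℝ) < r := h
        simp [radialKernel, h, h']
    simp only [e]
    rw [lintegral_radialMeasure (hm.indicator measurableSet_Ioi), ← lintegral_Ioi_mul_exp _ hs,
      ← lintegral_indicator measurableSet_Ioi, ← lintegral_indicator measurableSet_Ioi]
    refine lintegral_congr fun r => ?_
    by_cases h : (s : ℝ) < r
    · have h0 : 0 < r := hs.trans h
      rw [indicator_of_mem (show r ∈ Ioi 0 from h0), indicator_of_mem (show r ∈ Ioi (s : ℝ) from h),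
        indicator_of_mem (show r ∈ Ioi (s : ℝ) from h), ← ENNReal.ofReal_pow (by positivity),
        ← ENNReal.ofReal_mul (by positivity)]
      congr 1
      field_simp
    · simp [h]
  have hF : Measurable fun s : ℝ => ENNReal.ofReal (Real.exp (-s ^ 2) / 2) := by fun_prop
  have h2 := integral_rpow_mul_exp_neg_mul_rpow (p := 2) (q := 3) (b := 2) (by norm_num)
    (by norm_num) (by norm_num)
  have h3 : (2 : ℝ) ^ (-(3 + 1) / 2 : ℝ) * (1 / 2) * Real.Gamma ((3 + 1) / 2) = 1 / 8 := by
    have e1 : (-(3 + 1) / 2 : ℝ) = ((-2 : ℤ) : ℝ) := by norm_num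
    have e2 : ((3 + 1) / 2 : ℝ) = 2 := by norm_num
    rw [e1, e2, Real.rpow_intCast, Real.Gamma_two]
    norm_num
  rw [h3] at h2
  have hint : IntegrableOn (fun x : ℝ => x ^ (3 : ℝ) * Real.exp (-2 * x ^ (2 : ℝ))) (Ioi 0) := by
    by_contra h
    rw [integral_undef h] at h2
    norm_num at h2
  rw [lintegral_prod_symm _ (measurable_radialKernel.pow_const 2).aemeasurable]
  simp only [h1]
  rw [lintegral_radialMeasure hF]
  have h4 := ofReal_integral_eq_lintegral_ofReal (hint.const_mul (1 / 2)) (by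
    filter_upwards [ae_restrict_mem measurableSet_Ioi] with x hx
    have hx : 0 < x := hx
    simp only [Pi.zero_apply]
    positivity)
  rw [integral_const_mul, h2] at h4
  norm_num at h4 ⊢
  rw [h4]
  refine setLIntegral_congr_fun measurableSet_Ioi fun s hs => ?_
  have hs : 0 < s := hs
  have e : Real.exp (-(2 * s ^ 2)) = Real.exp (-s ^ 2) * Real.exp (-s ^ 2) := by
    rw [← Real.exp_add]
    congr 1
    ring
  rw [← ENNReal.ofReal_mul (by positivity), ← ENNReal.ofReal_mul (by positivity), e]
  congr 1
  ring

/-- The arithmetic-geometric mean inequality. The additive form can be summed over the index of the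
power series without a further Cauchy-Schwarz. -/
lemma le_of_sq_le_mul {X A B : ℝ≥0∞} (h : X ^ 2 ≤ ENNReal.ofReal (1 / 16) * (A * B)) :
    X ≤ ENNReal.ofReal (1 / 8) * (A + B) := by
  by_cases hA : A = ∞
  · simp [hA]
  by_cases hB : B = ∞
  · simp [hB]
  lift A to ℝ≥0 using hA
  lift B to ℝ≥0 using hB
  have hX : X ≠ ∞ := by
    rintro rfl
    have : ENNReal.ofReal (1 / 16) * ((A : ℝ≥0∞) * B) < ∞ := by finiteness
    exact absurd (h.trans_lt this) (by simp)
  lift X to ℝ≥0 using hX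
  have e : ∀ x : ℝ, ENNReal.ofReal x = ((x.toNNReal : ℝ≥0) : ℝ≥0∞) := fun _ => rfl
  rw [e] at h ⊢
  norm_cast at h ⊢
  have h' : (X : ℝ) ^ 2 ≤ (1 / 16) * (A * B) := by
    have := NNReal.coe_le_coe.2 h
    rwa [NNReal.coe_pow, NNReal.coe_mul, NNReal.coe_mul, Real.coe_toNNReal _ (by norm_num)] at this
  rw [← NNReal.coe_le_coe, NNReal.coe_mul, NNReal.coe_add, Real.coe_toNNReal _ (by norm_num)]
  refine (sq_le_sq₀ X.coe_nonneg (by positivity)).1 ?_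
  nlinarith [sq_nonneg ((A : ℝ) - B)]

lemma lintegral_radialKernel_mul_le {u v : Ioi (0 : ℝ) → ℝ≥0∞} (hu : Measurable u)
    (hv : Measurable v) :
    ∫⁻ x, radialKernel x * (u x.1 * v x.2) ∂radialMeasure.prod radialMeasure ≤
      ENNReal.ofReal (1 / 8) *
        (∫⁻ r, u r ^ 2 ∂radialMeasure + ∫⁻ r, v r ^ 2 ∂radialMeasure) := by
  apply le_of_sq_le_mul
  refine (sq_lintegral_mul_le measurable_radialKernel.aemeasurable
    ((hu.comp measurable_fst).mul (hv.comp measurable_snd)).aemeasurable).trans_eq ?_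
  rw [lintegral_sq_radialKernel]
  simp only [mul_pow, Pi.mul_apply, Function.comp_apply]
  rw [lintegral_prod_mul (hu.pow_const 2).aemeasurable (hv.pow_const 2).aemeasurable]

lemma lintegral_radialKernel_swap_mul_le {u v : Ioi (0 : ℝ) → ℝ≥0∞} (hu : Measurable u)
    (hv : Measurable v) :
    ∫⁻ x, radialKernel x.swap * (u x.1 * v x.2) ∂radialMeasure.prod radialMeasure ≤
      ENNReal.ofReal (1 / 8) *
        (∫⁻ r, u r ^ 2 ∂radialMeasure + ∫⁻ r, v r ^ 2 ∂radialMeasure) := by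
  have h := lintegral_radialKernel_mul_le hv hu
  rw [← lintegral_prod_swap, add_comm] at h
  simpa only [Prod.fst_swap, Prod.snd_swap, mul_comm (v _)] using h

/-- Neither power series of the kernel covers equal radii, so the diagonal has to be negligible. -/
lemma ae_ne_radialMeasure :
    ∀ᵐ x ∂radialMeasure.prod radialMeasure, x.1 ≠ x.2 := by
  have hm : MeasurableSet {x : Ioi (0 : ℝ) × Ioi (0 : ℝ) | x.1 ≠ x.2} :=
    (measurableSet_eq_fun measurable_fst measurable_snd).compl
  refine (Measure.ae_prod_iff_ae_ae hm).2 (Filter.Eventually.of_forall fun r => ?_)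
  rw [ae_iff]
  have h := lintegral_radialMeasure (F := ({(r : ℝ)} : Set ℝ).indicator 1)
    (measurable_one.indicator (measurableSet_singleton _))
  have e : ∀ s : Ioi (0 : ℝ), ({(r : ℝ)} : Set ℝ).indicator (1 : ℝ → ℝ≥0∞) s =
      ({r} : Set (Ioi (0 : ℝ))).indicator 1 s := by
    intro s
    by_cases hs : s = r
    · simp [hs]
    · simp [hs, Subtype.coe_inj]
  simp only [e] at h
  rw [lintegral_indicator_one (measurableSet_singleton _)] at h
  have hset : {a | ¬ (r, a).1 ≠ (r, a).2} = {r} := by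
    ext a
    simp [eq_comm]
  rw [hset, h]
  refine (lintegral_congr_ae ?_).trans (lintegral_zero)
  refine ae_restrict_of_ae ?_
  have : ∀ᵐ s ∂(volume : Measure ℝ), s ≠ (r : ℝ) := by simp [ae_iff]
  filter_upwards [this] with s hs
  simp [hs]

/-! ### Polar coordinates -/
/-! ### The norm of the Cauchy transform -/

lemma measurePreserving_prod_prod_comm {α β γ δ : Type*} [MeasurableSpace α] [MeasurableSpace β]
    [MeasurableSpace γ] [MeasurableSpace δ] (μa : Measure α) (μb : Measure β) (μc : Measure γ)
    (μd : Measure δ) [SFinite μa] [SFinite μb] [SFinite μc] [SFinite μd] :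
    MeasurePreserving (fun x : (α × β) × (γ × δ) => ((x.1.1, x.2.1), (x.1.2, x.2.2)))
      ((μa.prod μb).prod (μc.prod μd)) ((μa.prod μc).prod (μb.prod μd)) := by
  have hm : Measurable (fun x : (α × β) × (γ × δ) => ((x.1.1, x.2.1), (x.1.2, x.2.2))) := by
    fun_prop
  refine ⟨hm, Measure.ext_of_lintegral _ fun f hf => ?_⟩
  rw [lintegral_map hf hm, lintegral_prod _ (by fun_prop), lintegral_prod _ (by fun_prop),
    lintegral_prod _ (by fun_prop), lintegral_prod _ (by fun_prop)]
  refine lintegral_congr fun a => ?_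
  rw [lintegral_congr fun b => lintegral_prod (μ := μc) (ν := μd) (fun y => f ((a, y.1), (b, y.2)))
    (by fun_prop), lintegral_lintegral_swap (by fun_prop)]
  refine lintegral_congr fun c => ?_
  rw [lintegral_prod _ (by fun_prop)]

lemma measurePreserving_polarMap_prod :
    MeasurePreserving (fun x : (Ioi (0 : ℝ) × Ioi (0 : ℝ)) × USphere × USphere =>
        (polarMap (x.1.1, x.2.1), polarMap (x.1.2, x.2.2)))
      ((radialMeasure.prod radialMeasure).prod (sphereMeasure.prod sphereMeasure))
      (gaussMeasure.prod gaussMeasure) :=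
  (measurePreserving_polarMap.prod measurePreserving_polarMap).comp
    (measurePreserving_prod_prod_comm radialMeasure radialMeasure sphereMeasure sphereMeasure)

/-- The norm is taken only after integrating over the two spheres, so that the cancellation between
powers is kept. If `Φ` is not integrable, its integral is 0 by convention. -/
lemma enorm_integral_gaussMeasure_prod_le {Φ : ℍ × ℍ → ℍ}
    (hΦ : AEStronglyMeasurable Φ (gaussMeasure.prod gaussMeasure)) :
    ‖∫ x, Φ x ∂gaussMeasure.prod gaussMeasure‖ₑ ≤
      ∫⁻ x, ‖∫ y : USphere × USphere, Φ (polarMap (x.1, y.1), polarMap (x.2, y.2))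
        ∂sphereMeasure.prod sphereMeasure‖ₑ ∂radialMeasure.prod radialMeasure := by
  by_cases hi : Integrable Φ (gaussMeasure.prod gaussMeasure)
  · have h := measurePreserving_polarMap_prod
    rw [← h.map_eq, integral_map h.measurable.aemeasurable (by rwa [h.map_eq]), integral_prod]
    · exact enorm_integral_le_lintegral_enorm _
    · exact h.integrable_comp_of_integrable hi
  · simp [integral_undef hi]

/-- The norms of the Fourier coefficients of the restrictions to the spheres centered at zero. -/
def radialCoeff (m : ℤ) (f : ℍ → ℍ) (r : Ioi (0 : ℝ)) : ℝ≥0∞ :=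
  ‖sphereCoeff m fun ω => f (polarMap (r, ω))‖ₑ

lemma measurable_radialCoeff {f : ℍ → ℍ} (hf : Measurable f) (m : ℤ) :
    Measurable (radialCoeff m f) := by
  refine (StronglyMeasurable.integral_prod_right
    (f := fun (r : Ioi (0 : ℝ)) (ω : USphere) => (ω : ℍ) ^ (-m) * f (polarMap (r, ω)))
    (Measurable.stronglyMeasurable ?_)).measurable.enorm
  exact ((continuous_zpow_uSphere (-m)).measurable.comp measurable_snd).mul
    (hf.comp measurable_polarMap)

lemma tsum_lintegral_radialCoeff_sq_le {f : ℍ → ℍ} (hf : Measurable f) :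
    ∑' m, ∫⁻ r, radialCoeff m f r ^ 2 ∂radialMeasure ≤
      ENNReal.ofReal (4 * Real.pi ^ 2) * ∫⁻ q, ‖f q‖ₑ ^ 2 ∂gaussMeasure := by
  have hm : Measurable fun x => ‖f (polarMap x)‖ₑ ^ 2 :=
    (hf.comp measurable_polarMap).enorm.pow_const 2
  rw [← lintegral_tsum fun m => ((measurable_radialCoeff hf m).pow_const 2).aemeasurable,
    ← measurePreserving_polarMap.lintegral_comp (hf.enorm.pow_const 2), lintegral_prod _ hm.aemeasurable,
    ← lintegral_const_mul _ hm.lintegral_prod_right']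
  refine lintegral_mono fun r => tsum_enorm_sphereCoeff_sq_le ?_
  exact (hf.comp (measurable_polarMap.comp measurable_prodMk_left)).aestronglyMeasurable

lemma ae_integrable_polarMap {f : ℍ → ℍ} (hf : MemLp f 2 gaussMeasure) :
    ∀ᵐ r ∂radialMeasure, Integrable (fun ω => f (polarMap (r, ω))) sphereMeasure :=
  (measurePreserving_polarMap.integrable_comp_of_integrable
    (hf.integrable (by norm_num))).prod_right_ae

lemma ae_enorm_integral_cauchyKernel_le {f g : ℍ → ℍ} (hf : MemLp f 2 gaussMeasure)
    (hg : MemLp g 2 gaussMeasure) :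
    ∀ᵐ x ∂radialMeasure.prod radialMeasure, ‖∫ y : USphere × USphere,
        star (g (polarMap (x.1, y.1))) * cauchyKernel (polarMap (x.1, y.1)) (polarMap (x.2, y.2)) *
          f (polarMap (x.2, y.2)) ∂sphereMeasure.prod sphereMeasure‖ₑ ≤
      ∑' n : ℕ, radialKernel x.swap * (radialCoeff n g x.1 * radialCoeff (n + 1) f x.2) +
      ∑' n : ℕ, radialKernel x *
        (radialCoeff (-(n + 1)) g x.1 * radialCoeff (-(n + 1) + 1) f x.2) := by
  filter_upwards [ae_ne_radialMeasure,
    Measure.quasiMeasurePreserving_fst.ae (ae_integrable_polarMap hg),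
    Measure.quasiMeasurePreserving_snd.ae (ae_integrable_polarMap hf)] with x hx hxg hxf
  rcases lt_or_gt_of_ne hx with h | h
  · refine (enorm_integral_cauchyKernel_le_of_gt hxf hxg x.1.2 h).trans
      (le_trans (ENNReal.tsum_le_tsum fun n => le_of_eq ?_) le_self_add)
    rw [radialKernel, indicator_of_mem (by exact h)]
    rfl
  · refine (enorm_integral_cauchyKernel_le_of_lt hxf hxg x.2.2 h).trans
      (le_trans (ENNReal.tsum_le_tsum fun n => le_of_eq ?_) le_add_self)
    rw [radialKernel, indicator_of_mem (by exact h), neg_add, neg_add_cancel_right, ← neg_add]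
    rfl

lemma enorm_integral_star_mul_cauchyKernel_mul_le {f g : ℍ → ℍ} (hf : Measurable f)
    (hg : Measurable g) (hf2 : MemLp f 2 gaussMeasure) (hg2 : MemLp g 2 gaussMeasure) :
    ‖∫ x, star (g x.1) * cauchyKernel x.1 x.2 * f x.2 ∂gaussMeasure.prod gaussMeasure‖ₑ ≤
      ENNReal.ofReal (Real.pi ^ 2 / 2) *
        (∫⁻ q, ‖g q‖ₑ ^ 2 ∂gaussMeasure + ∫⁻ q, ‖f q‖ₑ ^ 2 ∂gaussMeasure) := by
  have hm : Measurable fun x : ℍ × ℍ => star (g x.1) * cauchyKernel x.1 x.2 * f x.2 :=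
    ((continuous_star.measurable.comp (hg.comp measurable_fst)).mul measurable_cauchyKernel).mul
      (hf.comp measurable_snd)
  have mc : ∀ m l, Measurable fun x : Ioi (0 : ℝ) × Ioi (0 : ℝ) =>
      radialCoeff m g x.1 * radialCoeff l f x.2 := fun m l =>
    ((measurable_radialCoeff hg m).comp measurable_fst).mul
      ((measurable_radialCoeff hf l).comp measurable_snd)
  have m1 : ∀ m l, Measurable fun x : Ioi (0 : ℝ) × Ioi (0 : ℝ) =>
      radialKernel x * (radialCoeff m g x.1 * radialCoeff l f x.2) := fun m l =>
    measurable_radialKernel.mul (mc m l)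
  have m2 : ∀ m l, Measurable fun x : Ioi (0 : ℝ) × Ioi (0 : ℝ) =>
      radialKernel x.swap * (radialCoeff m g x.1 * radialCoeff l f x.2) := fun m l =>
    (measurable_radialKernel.comp measurable_swap).mul (mc m l)
  set a : ℤ → ℝ≥0∞ := fun m => ∫⁻ r, radialCoeff m g r ^ 2 ∂radialMeasure with ha
  set b : ℤ → ℝ≥0∞ := fun m => ∫⁻ r, radialCoeff m f r ^ 2 ∂radialMeasure with hb
  refine (enorm_integral_gaussMeasure_prod_le hm.aestronglyMeasurable).trans
    ((lintegral_mono_ae (ae_enorm_integral_cauchyKernel_le hf2 hg2)).trans ?_)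
  rw [lintegral_add_left (Measurable.tsum fun n => m2 _ _),
    lintegral_tsum fun n => (m2 _ _).aemeasurable, lintegral_tsum fun n => (m1 _ _).aemeasurable]
  calc _ ≤ ∑' n : ℕ, ENNReal.ofReal (1 / 8) * (a n + b (n + 1)) +
        ∑' n : ℕ, ENNReal.ofReal (1 / 8) * (a (-(n + 1)) + b (-(n + 1) + 1)) :=
        add_le_add
          (ENNReal.tsum_le_tsum fun n => lintegral_radialKernel_swap_mul_le
            (measurable_radialCoeff hg _) (measurable_radialCoeff hf _))
          (ENNReal.tsum_le_tsum fun n => lintegral_radialKernel_mul_le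
            (measurable_radialCoeff hg _) (measurable_radialCoeff hf _))
    -- The two series run over m ≥ 0 and m < 0. In both, the index of `f` is m + 1, so over all
    -- integers each coefficient of `g` and of `f` is used exactly once.
    _ = ENNReal.ofReal (1 / 8) * (∑' m, a m + ∑' m, b m) := by
        rw [← tsum_of_nat_of_neg_add_one (f := fun m : ℤ => ENNReal.ofReal (1 / 8) *
          (a m + b (m + 1))) ENNReal.summable ENNReal.summable, ENNReal.tsum_mul_left,
          ENNReal.tsum_add, ← (Equiv.addRight (1 : ℤ)).tsum_eq b]
        rfl
    _ ≤ ENNReal.ofReal (1 / 8) *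
        (ENNReal.ofReal (4 * Real.pi ^ 2) * ∫⁻ q, ‖g q‖ₑ ^ 2 ∂gaussMeasure +
          ENNReal.ofReal (4 * Real.pi ^ 2) * ∫⁻ q, ‖f q‖ₑ ^ 2 ∂gaussMeasure) := by
        gcongr
        · exact tsum_lintegral_radialCoeff_sq_le hg
        · exact tsum_lintegral_radialCoeff_sq_le hf
    _ = _ := by
        rw [← mul_add, ← mul_assoc, ← ENNReal.ofReal_mul (by norm_num)]
        congr 2
        ring

/-- This licenses Fubini for the bilinear form: Cauchy-Schwarz in `q` combines `g` with the Schur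
bound for the absolute integral of the kernel against `f`. -/
lemma integrable_star_mul_cauchyKernel_mul (f g : L2H) :
    Integrable (fun x : ℍ × ℍ => star (g x.1) * (cutKernel univ x.1 x.2 * f x.2))
      (gaussMeasure.prod gaussMeasure) := by
  have hk := isSchurKernel_cutKernel MeasurableSet.univ
  have hm : AEStronglyMeasurable (fun x : ℍ × ℍ => cutKernel univ x.1 x.2 * f x.2)
      (gaussMeasure.prod gaussMeasure) := hk.aestronglyMeasurable_mul f
  have hm' : AEStronglyMeasurable (fun x : ℍ × ℍ => star (g x.1) * (cutKernel univ x.1 x.2 * f x.2))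
      (gaussMeasure.prod gaussMeasure) :=
    (continuous_star.comp_aestronglyMeasurable (Lp.aestronglyMeasurable g).comp_fst).mul hm
  refine ⟨hm', ?_⟩
  rw [HasFiniteIntegral, lintegral_prod _ hm'.enorm]
  have e : ∀ q, ∫⁻ p, ‖star (g q) * (cutKernel univ q p * f p)‖ₑ ∂gaussMeasure =
      ‖g q‖ₑ * ∫⁻ p, ‖cutKernel univ q p * f p‖ₑ ∂gaussMeasure := by
    intro q
    rw [← lintegral_const_mul' _ _ enorm_ne_top]
    refine lintegral_congr fun p => ?_
    rw [enorm_mul, ← ofReal_norm (star _), norm_star, ofReal_norm]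
  simp only [e]
  have h := sq_lintegral_mul_le (aemeasurable_enorm_coeFn g) hm.enorm.lintegral_prod_right'
  have h2 := h.trans (mul_le_mul_right (hk.lintegral_sq_coeFn_le f) _)
  rw [← enorm_sq_eq_lintegral] at h2
  rw [lt_top_iff_ne_top]
  intro h3
  rw [h3, ENNReal.top_pow two_ne_zero] at h2
  exact absurd (h2.trans_lt (by finiteness : _ < ∞)) (lt_irrefl _)

lemma qInner_cauchyCLM (f g : L2H) : qInner g (cauchyCLM f) = (1 / Real.pi : ℝ) •
    ∫ x, star (g x.1) * cauchyKernel x.1 x.2 * f x.2 ∂gaussMeasure.prod gaussMeasure := by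
  have hk := isSchurKernel_cutKernel MeasurableSet.univ
  have e : ∀ x : ℍ × ℍ, (1 / Real.pi : ℝ) • (star (g x.1) * cauchyKernel x.1 x.2 * f x.2) =
      star (g x.1) * (cutKernel univ x.1 x.2 * f x.2) := by
    intro x
    rw [cutKernel_univ, smul_mul_assoc, mul_smul_comm, mul_assoc]
  rw [← integral_smul]
  simp only [e]
  rw [integral_prod _ (integrable_star_mul_cauchyKernel_mul f g), qInner]
  refine integral_congr_ae ?_
  filter_upwards [hk.ae_integrable f, hk.toCLM_ae_eq f] with q h1 h2
  rw [integral_const_mul_of_integrable h1, ← h2]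
  rfl

lemma norm_qInner_cauchyCLM_le (f g : L2H) :
    ‖qInner g (cauchyCLM f)‖ ≤ Real.pi / 2 * (‖g‖ ^ 2 + ‖f‖ ^ 2) := by
  have h := enorm_integral_star_mul_cauchyKernel_mul_le (Lp.stronglyMeasurable f).measurable
    (Lp.stronglyMeasurable g).measurable (Lp.memLp f) (Lp.memLp g)
  rw [← enorm_sq_eq_lintegral, ← enorm_sq_eq_lintegral] at h
  have h' := ENNReal.toReal_mono (by finiteness) h
  rw [ENNReal.toReal_mul, ENNReal.toReal_add (by finiteness) (by finiteness), ENNReal.toReal_pow,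
    ENNReal.toReal_pow, toReal_enorm, toReal_enorm, toReal_enorm,
    ENNReal.toReal_ofReal (by positivity)] at h'
  have hpi := Real.pi_pos
  rw [qInner_cauchyCLM, norm_smul, Real.norm_of_nonneg (by positivity)]
  calc _ ≤ 1 / Real.pi * (Real.pi ^ 2 / 2 * (‖g‖ ^ 2 + ‖f‖ ^ 2)) := by gcongr
    _ = _ := by field_simp

lemma norm_cauchyCLM_le : ‖cauchyCLM.restrictScalars ℝ‖ ≤ Real.pi := by
  refine ContinuousLinearMap.opNorm_le_of_unit_norm Real.pi_pos.le fun f hf => ?_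
  change ‖cauchyCLM f‖ ≤ Real.pi
  by_cases h0 : ‖cauchyCLM f‖ = 0
  · rw [h0]
    exact Real.pi_pos.le
  -- Testing against the normalised image turns the bound π/2 (‖g‖² + ‖f‖²) into π.
  set g : L2H := ‖cauchyCLM f‖⁻¹ • cauchyCLM f with hg
  have hg1 : ‖g‖ = 1 := norm_smul_inv_norm (𝕜 := ℝ) (norm_ne_zero_iff.1 h0)
  have h1 : (qInner g (cauchyCLM f)).re = ‖cauchyCLM f‖ := by
    rw [← inner_eq_re_qInner, hg, real_inner_smul_left, real_inner_self_eq_norm_sq]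
    field_simp
  have h2 : |(qInner g (cauchyCLM f)).re| ≤ ‖qInner g (cauchyCLM f)‖ := by
    have := abs_real_inner_le_norm (1 : ℍ) (qInner g (cauchyCLM f))
    simpa [inner_eq_re] using this
  have h3 := norm_qInner_cauchyCLM_le f g
  rw [hg1, hf] at h3
  rw [← h1]
  linarith [le_abs_self (qInner g (cauchyCLM f)).re]

lemma hemisphereArea_eq : hemisphereArea = 2 * Real.pi := by
  simp [hemisphereArea]
  ring

lemma pi_le_hemisphereArea_div : Real.pi ≤ hemisphereArea / √Real.pi := by
  have h : √Real.pi ≤ 2 := Real.sqrt_le_iff.2 ⟨by norm_num, by linarith [Real.pi_le_four]⟩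
  rw [hemisphereArea_eq, le_div_iff₀ (Real.sqrt_pos.2 Real.pi_pos)]
  nlinarith [Real.pi_pos]

end QuatCauchy

end

theorem mainTheorem1 :
    ∃ C : QuatCauchy.L2H →L[ℍᵐᵒᵖ] QuatCauchy.L2H,
      (∀ f : QuatCauchy.L2H, ∀ᵐ q ∂QuatCauchy.gaussMeasure,
        Integrable (fun p => QuatCauchy.cauchyKernel q p * f p) QuatCauchy.gaussMeasure ∧
          C f q = QuatCauchy.cauchyTransform f q) ∧
      ‖C.restrictScalars ℝ‖ ≤ QuatCauchy.hemisphereArea / Real.sqrt Real.pi ∧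
      IsCompactOperator C ∧
      ∀ k : ℝ, 2 < k → QuatCauchy.IsSchatten k C := by
  open QuatCauchy in
  exact ⟨cauchyCLM, ae_integrable_cauchyCLM, norm_cauchyCLM_le.trans pi_le_hemisphereArea_div,
    hasHilbertSchmidtSplitting_cauchyCLM.isCompactOperator, fun k hk =>
      hasHilbertSchmidtSplitting_cauchyCLM.isSchatten hk⟩
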